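/- **Setting.** $E$ is a finite set of $n$ items, $O$ a set of states, and $p$ a (discrete) probability distribution on the set $O^E$ of realizations; $\Phi\sim p$. Let $f:2^E\times O^E\to\mathbb R_{\ge 0}$ be a utility function with $\mathbb E[f(S,\Phi)]<\infty$ for all $S\subseteq E$. A partial realization $\psi$ is a map from a set $\mathrm{dom}(\psi)\subseteq E$ to $O$; $\phi\sim\psi$ means that $\phi$ agrees with $\psi$ on $\mathrm{dom}(\psi)$, and $\psi\subseteq\psi'$ that $\psi'$ extends $\psi$. For $\Pr[\Phi\sim\psi]>0$ put $$\Delta(e\mid\psi)=\mathbb E\big[f(\mathrm{dom}(\psi)\cup\{e\},\Phi)-f(\mathrm{dom}(\psi),\Phi)\,\big|\,\Phi\sim\psi\big].$$ $f$ is *adaptive monotone* if $\Delta(e\mid\psi)\ge 0$ for all $e\in E$ and all $\psi$ with $\Pr[\Phi\sim\psi]>0$, and *adaptive submodular* if $\Delta(e\mid\psi)\ge\Delta(e\mid\psi')$ for all $\psi\subseteq\psi'$ with $\Pr[\Phi\sim\psi']>0$ and all $e\in E\setminus\mathrm{dom}(\psi')$. An (adaptive, possibly randomized) *policy* $\pi$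 runs for a fixed finite number of rounds; in each round it sees the states of the items selected so far and selects an item, or none, by a randomized rule that depends on the round and on this observation and may use a value oracle, which returns $\Delta(e\mid\psi)$ for a queried pair $(e,\psi)$. $E(\pi,\phi)$ is the (random) set of items selected under $\phi$, and $f_{avg}(\pi)=\mathbb E[f(E(\pi,\Phi),\Phi)]$. $\pi$ is *feasible* if $|E(\pi,\phi)|\le k$ (almost surely) for all $\phi\in O^E$. **Linear-Time Adaptive Policy $\pi^{lt}$** with parameters $k$ and $q$: let $m=\min\{\lceil qn\rceil,n\}$ and $s=km/n$. In each of $k$ rounds, with current partial realization $\psi$: draw a uniformly random $m$-element set $S\subseteq E$ and, independently, $d$ uniform on $(0,s]$; query $\Delta(e\mid\psi)$ for all $e\in S$; let $e'$ be the item of $S$ with the $\lceil d\rceil$-th largest marginal utility $\Delta(\cdot\mid\psi)$ (ties broken by an arbitrary rule); select $e'$ if $\Delta(e'\mid\psi)\ge 0$, and nothing otherwise. **Theorem.** There is an absolute constant $C>0$ such that the following holds. Let $f$ be adaptive submodular and adaptive monotone, let $1\le k\le n$ be integers, and let $\epsilon>0$ and $q$ satisfy one of 1. $q=8k^{-1}\epsilon^{-2}\ln\big((2\epsilon)^{-1}\big)$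 and $\epsilon\le 12/25$, or 2. $q=8k^{-1}\epsilon^{-2}\ln\big(2\epsilon^{-1}\big)$ and $\epsilon<1-1/e$. Then, for every tie-breaking rule, $\pi^{lt}$ is feasible, $$f_{avg}(\pi^{lt})\ \ge\ (1-1/e-\epsilon)\,f_{avg}(\pi)\qquad\text{for every feasible policy }\pi,$$ and under every realization every execution of $\pi^{lt}$ makes at most $C\,n\,\epsilon^{-2}\ln(\epsilon^{-1})$ value oracle queries. -/

import Mathlib

universe u v

open MeasureTheory ProbabilityTheory

noncomputable section

namespace AdaptiveMax

/-- A partial realization: the states of the items observed so far (`none` = not observed). -/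
abbrev PartialRealization (E : Type u) (O : Type v) : Type (max u v) := E → Option O

section Setting

variable {E : Type u} {O : Type v}

/-- The set of items whose state is recorded in `ψ`. -/
def dom [Fintype E] (ψ : PartialRealization E O) : Finset E :=
  Finset.univ.filter fun e => (ψ e).isSome

/-- `φ ∼ ψ`: the realization `φ` agrees with `ψ` on the domain of `ψ`. -/
def Consistent (φ : E → O) (ψ : PartialRealization E O) : Prop :=
  ∀ e o, ψ e = some o → φ e = o

/-- `ψ ⊆ ψ'`: `ψ` is a subrealization of `ψ'`. -/
def Subrealization (ψ ψ' : PartialRealization E O) : Prop :=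
  ∀ e o, ψ e = some o → ψ' e = some o

/-- The partial realization observed under `φ` once the items of `A` have been selected. -/
def observed [DecidableEq E] (φ : E → O) (A : Finset E) : PartialRealization E O :=
  fun e => if e ∈ A then some (φ e) else none

/-- `Pr[Φ ∼ ψ]`, where `Φ` is drawn from the prior `p`. -/
def prob (p : PMF (E → O)) (ψ : PartialRealization E O) : ℝ :=
  open Classical in ∑' φ, if Consistent φ ψ then (p φ).toReal else 0

/-- The conditional expectation `𝔼[g(Φ) | Φ ∼ ψ]` (used only when `Pr[Φ ∼ ψ] > 0`). -/
def condExpectation (p : PMF (E → O)) (ψ : PartialRealization E O) (g : (E → O) → ℝ) : ℝ :=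
  open Classical in (∑' φ, if Consistent φ ψ then (p φ).toReal * g φ else 0) / prob p ψ

variable [Fintype E] [DecidableEq E]

/-- The conditional expected marginal utility
`Δ(e | ψ) = 𝔼[f(dom ψ ∪ {e}, Φ) - f(dom ψ, Φ) | Φ ∼ ψ]`. -/
def marginal (p : PMF (E → O)) (f : Finset E → (E → O) → ℝ)
    (e : E) (ψ : PartialRealization E O) : ℝ :=
  condExpectation p ψ fun φ => f (insert e (dom ψ)) φ - f (dom ψ) φ

/-- Adaptive monotonicity with respect to the prior `p`. -/
def AdaptiveMonotone (p : PMF (E → O)) (f : Finset E → (E → O) → ℝ) : Prop :=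
  ∀ ψ : PartialRealization E O, 0 < prob p ψ → ∀ e : E, 0 ≤ marginal p f e ψ

/-- Adaptive submodularity with respect to the prior `p`. -/
def AdaptiveSubmodular (p : PMF (E → O)) (f : Finset E → (E → O) → ℝ) : Prop :=
  ∀ ψ ψ' : PartialRealization E O, Subrealization ψ ψ' → 0 < prob p ψ' →
    ∀ e ∉ dom ψ', marginal p f e ψ' ≤ marginal p f e ψ

end Setting

/-- Randomized computations with access to a value oracle: a computation can draw a (discrete)
random sample, query the oracle for the value of an item `e` at a partial realization `ψ`, and
finally return a result. -/
inductive OracleComp (E : Type u) (O : Type v) (α : Type u) : Type (max (u + 1) v)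
  | ret (a : α) : OracleComp E O α
  | sample {β : Type u} (μ : PMF β) (next : β → OracleComp E O α) : OracleComp E O α
  | query (e : E) (ψ : PartialRealization E O) (next : ℝ → OracleComp E O α) : OracleComp E O α

/-- The joint law of the result and of the number of oracle queries of a computation. -/
def OracleComp.run {E : Type u} {O : Type v} {α : Type u}
    (oracle : E → PartialRealization E O → ℝ) : OracleComp E O α → PMF (α × ℕ)
  | .ret a => PMF.pure (a, 0)
  | .sample μ next => μ.bind fun b => (next b).run oracle
  | .query e ψ next => ((next (oracle e ψ)).run oracle).map fun x => (x.1, x.2 + 1)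

/-- Query the oracle at `ψ` for all items of a list, and hand the list of the items together with
the answers to `next`. -/
def OracleComp.queryAll {E : Type u} {O : Type v} {α : Type u} (ψ : PartialRealization E O) :
    List E → (List (E × ℝ) → OracleComp E O α) → OracleComp E O α
  | [], next => next []
  | e :: l, next =>
    .query e ψ fun x => OracleComp.queryAll ψ l fun answers => next ((e, x) :: answers)

/-- An adaptive, possibly randomized, policy: in round `r` it looks at the current partial
realization `ψ` and decides (by a randomized computation, possibly with the help of the value
oracle) which item to select next, where `none` means that no item is selected in this round.
Every map from partial realizations to distributions on `Option E` is such a decision rule, by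
`fun ψ => .sample (μ ψ) .ret`. -/
structure Policy (E : Type u) (O : Type v) where
  rounds : ℕ
  step : ℕ → PartialRealization E O → OracleComp E O (Option E)

section Policies

variable {E : Type u} {O : Type v} [DecidableEq E]

/-- The joint law, under the realization `φ`, of the set of items that are selected and of the
number of oracle queries that are made in the first `r` rounds. -/
def Policy.runRounds (π : Policy E O) (oracle : E → PartialRealization E O → ℝ) (φ : E → O) :
    ℕ → PMF (Finset E × ℕ)
  | 0 => PMF.pure (∅, 0)
  | r + 1 => (π.runRounds oracle φ r).bind fun y =>
      ((π.step r (observed φ y.1)).run oracle).map fun x => (y.1 ∪ x.1.toFinset, y.2 + x.2)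

variable [Fintype E]

/-- The joint law of the set of selected items and of the total number of queries, under the
realization `φ`, when the value oracle returns `Δ(e | ψ)`. -/
def Policy.run (π : Policy E O) (p : PMF (E → O)) (f : Finset E → (E → O) → ℝ) (φ : E → O) :
    PMF (Finset E × ℕ) :=
  π.runRounds (marginal p f) φ π.rounds

/-- The law of `E(π, φ)`, the set of items that `π` selects under the realization `φ`. -/
def Policy.selected (π : Policy E O) (p : PMF (E → O)) (f : Finset E → (E → O) → ℝ)
    (φ : E → O) : PMF (Finset E) :=
  (π.run p f φ).map Prod.fst

/-- The expected utility `f_avg(π) = 𝔼[f(E(π, Φ), Φ)]`, over the prior and the internal randomness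
of `π`. -/
def Policy.favg (π : Policy E O) (p : PMF (E → O)) (f : Finset E → (E → O) → ℝ) : ℝ :=
  ∑' φ, (p φ).toReal * ∑ A : Finset E, (π.selected p f φ A).toReal * f A φ

/-- `π` is feasible: it selects at most `k` items for all realizations. -/
def Policy.Feasible (π : Policy E O) (p : PMF (E → O)) (f : Finset E → (E → O) → ℝ)
    (k : ℕ) : Prop :=
  ∀ φ : E → O, ∀ A ∈ (π.selected p f φ).support, A.card ≤ k

end Policies

section LinearTime

/-- The law of `⌈d⌉`, where `d` is uniformly distributed on the interval `(0, s]`, `s > 0`. -/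
def ceilUniform (s : ℝ) : PMF ℕ :=
  if h : 0 < s then
    have : IsProbabilityMeasure ((volume[|Set.Ioc 0 s]).map fun d : ℝ => ⌈d⌉₊) := by
      have : IsProbabilityMeasure ((volume : Measure ℝ)[|Set.Ioc 0 s]) :=
        cond_isProbabilityMeasure_of_finite (by simpa using h) (by simp)
      exact Measure.isProbabilityMeasure_map Nat.measurable_ceil.aemeasurable
    ((volume[|Set.Ioc 0 s]).map fun d : ℝ => ⌈d⌉₊).toPMF
  else PMF.pure 0

/-- The sample size `min {⌈q n⌉, n}`, where `n` is the number of items. -/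
def sampleSize (E : Type u) [Fintype E] (q : ℝ) : ℕ :=
  min ⌈q * Fintype.card E⌉₊ (Fintype.card E)

/-- A uniformly random set of `min {⌈q n⌉, n}` items. -/
def uniformSample (E : Type u) [Fintype E] (q : ℝ) : PMF (Finset E) :=
  PMF.uniformOfFinset (Finset.powersetCard (sampleSize E q) Finset.univ)
    (Finset.powersetCard_nonempty.2 (by simp [sampleSize]))

/-- `sort` puts every finite list of pairs `(e, x)` into an order of non-increasing `x`; ties may
be broken in any way. -/
def IsDescendingSort {E : Type u} (sort : List (E × ℝ) → List (E × ℝ)) : Prop :=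
  ∀ l, (sort l).Perm l ∧ (sort l).Pairwise fun a b => b.2 ≤ a.2

/-- The item of the entry in position `j` (counted from `1`) of a list, if the value of this entry
is nonnegative; otherwise no item. -/
def pick {E : Type u} (l : List (E × ℝ)) (j : ℕ) : Option E :=
  match l[j - 1]? with
  | some (e, x) => if 0 ≤ x then some e else none
  | none => none

/-- The Linear-Time Adaptive Policy with parameters `k`, `q` and `s = k min {⌈q n⌉, n} / n`. In each
of `k` rounds it draws a random set `S` and, independently, a number `d` uniformly from `(0, s]`,
queries `Δ(e | ψ)` for all `e ∈ S`, and selects the item of `S` that has the `⌈d⌉`-th largest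
marginal utility, provided that this marginal utility is nonnegative. -/
def linearTimePolicy (E : Type u) (O : Type v) [Fintype E]
    (sort : List (E × ℝ) → List (E × ℝ)) (k : ℕ) (q : ℝ) : Policy E O where
  rounds := k
  step _ ψ :=
    .sample
      ((uniformSample E q).bind fun S =>
        (ceilUniform (k * sampleSize E q / Fintype.card E)).map fun j => (S, j))
      fun Sj => .queryAll ψ Sj.1.toList fun answers => .ret (pick (sort answers) Sj.2)

end LinearTime

end AdaptiveMax

end

open AdaptiveMax

/-!
The utility of a policy is compared with that of any feasible policy `π` round by round, as in the
analysis of the greedy algorithm. The law of the set selected by a policy is *adapted*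
(`Policy.adaptedTo_law`): the probability of selecting `A` depends on the states of the items of
`A` only. Therefore (`mean_weight_mul_marginal`) the expected increase of the utility when `e` is
added to `A` is the expectation of the marginal utility `Δ(e | ψ)` at the observation `ψ` made on
`A`. Let `τ` be a policy, let `B` be the set that it has selected after `r` rounds, and let `A` be
the set selected by a run of `π` on the same realization with independent random choices. Since
the order of the two runs does not matter for `A ∪ B`, adaptive monotonicity gives
`f_avg(π) ≤ 𝔼[f(A ∪ B, Φ)]` (`Policy.meanLE_union`), and adaptive submodularity gives
`𝔼[f(A ∪ B, Φ)] ≤ 𝔼[f(B, Φ)] + 𝔼[∑ e ∈ A, Δ(e | ψ_B)]`, where `ψ_B` is the observation made on `B`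
(`Policy.meanLE_union_marginal`). If every round of `τ` gains in expectation at least a fraction
`c` of the total marginal utility of any `k` items, it follows that a round closes a fraction `c`
of the gap to `f_avg(π)` (`Policy.le_value_succ`).

For the linear-time policy this holds with `c = (1 - ε) / k` (`le_gain_linearTimePolicy`). Let `M`
be a set of `k` items, and let `N` be the number of them in the random set `S`, so that
`𝔼[N] = s`. Given `S`, Chebyshev's sum inequality for the random rank, whose probabilities are
non-increasing and sum to `min s N / s` over the first `N` ranks, shows that the expected gain is
at least the total marginal utility of `S ∩ M` divided by `max s N` (`le_tsum_ceilUniform_pick`);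
it is not necessary that `M` consists of the best items. By symmetry all items of `M` contribute
to the average over `S` with the same weight `𝔼[N / max s N] / k` (`card_mul_sum_mem`). Finally
`N` is hypergeometric with variance at most `s`, and a second moment estimate gives
`𝔼[N / max s N] ≥ 1 - ε` as soon as `s ≥ 1 / (4 ε²)` (`one_sub_le_sum_div_max`), which both
choices of `q` guarantee unless `S` is the set of all items. The constant then comes from
`(1 - (1 - ε) / k) ^ k ≤ e ^ (ε - 1) ≤ 1 / e + ε`.
-/

noncomputable section

namespace AdaptiveMax

/-! ### Expectations over a discrete distribution -/

section Expectation

variable {Ω : Type*}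

/-- The expectation of `g` under the discrete distribution `p`; it is `0` if the series does not
converge absolutely, see `HasMean`. -/
def mean (p : PMF Ω) (g : Ω → ℝ) : ℝ := ∑' φ, (p φ).toReal * g φ

/-- The expectation of `g` under `p` converges absolutely. -/
def HasMean (p : PMF Ω) (g : Ω → ℝ) : Prop := Summable fun φ => (p φ).toReal * g φ

/-- Both expectations converge, and `𝔼[g] ≤ 𝔼[h]`. Bundling convergence with the inequality lets
inequalities between expectations be added up without side conditions. -/
def MeanLE (p : PMF Ω) (g h : Ω → ℝ) : Prop := HasMean p g ∧ HasMean p h ∧ mean p g ≤ mean p h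

variable {p : PMF Ω} {g h g' h' : Ω → ℝ}

lemma summable_toReal (p : PMF Ω) : Summable fun φ => (p φ).toReal :=
  ENNReal.summable_toReal p.tsum_coe_ne_top

lemma HasMean.add (hg : HasMean p g) (hh : HasMean p h) : HasMean p fun φ => g φ + h φ := by
  simpa only [HasMean, mul_add] using Summable.add hg hh

lemma HasMean.sub (hg : HasMean p g) (hh : HasMean p h) : HasMean p fun φ => g φ - h φ := by
  simpa only [HasMean, mul_sub] using Summable.sub hg hh

lemma HasMean.neg (hg : HasMean p g) : HasMean p fun φ => -g φ := by
  simpa only [HasMean, mul_neg] using Summable.neg hg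

lemma HasMean.const_mul (c : ℝ) (hg : HasMean p g) : HasMean p fun φ => c * g φ := by
  simpa only [HasMean, mul_left_comm] using Summable.mul_left c hg

lemma HasMean.sum {ι : Type*} (s : Finset ι) {g : ι → Ω → ℝ} (hg : ∀ i ∈ s, HasMean p (g i)) :
    HasMean p fun φ => ∑ i ∈ s, g i φ := by
  simpa only [HasMean, Finset.mul_sum] using summable_sum hg

lemma HasMean.weight_mul {G : Ω → ℝ} (hg : HasMean p g) (h0 : ∀ φ, 0 ≤ G φ) (h1 : ∀ φ, G φ ≤ 1) :
    HasMean p fun φ => G φ * g φ := by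
  refine Summable.of_norm_bounded (Summable.abs hg) fun φ => ?_
  rw [Real.norm_eq_abs, mul_left_comm, abs_mul (G φ), abs_of_nonneg (h0 φ)]
  exact mul_le_of_le_one_left (abs_nonneg _) (h1 φ)

lemma mean_add (hg : HasMean p g) (hh : HasMean p h) :
    mean p (fun φ => g φ + h φ) = mean p g + mean p h := by
  simpa only [mean, mul_add] using Summable.tsum_add hg hh

lemma mean_neg : mean p (fun φ => -g φ) = -mean p g := by
  simpa only [mean, mul_neg] using tsum_neg

lemma mean_const_mul (c : ℝ) : mean p (fun φ => c * g φ) = c * mean p g := by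
  simpa only [mean, mul_left_comm] using tsum_mul_left

lemma mean_sum {ι : Type*} (s : Finset ι) {g : ι → Ω → ℝ} (hg : ∀ i ∈ s, HasMean p (g i)) :
    mean p (fun φ => ∑ i ∈ s, g i φ) = ∑ i ∈ s, mean p (g i) := by
  simpa only [mean, Finset.mul_sum] using Summable.tsum_finsetSum hg

lemma HasMean.meanLE_self (hg : HasMean p g) : MeanLE p g g := ⟨hg, hg, le_rfl⟩

lemma MeanLE.trans (h₁ : MeanLE p g h) (h₂ : MeanLE p h h') : MeanLE p g h' :=
  ⟨h₁.1, h₂.2.1, h₁.2.2.trans h₂.2.2⟩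

lemma MeanLE.add (h₁ : MeanLE p g h) (h₂ : MeanLE p g' h') :
    MeanLE p (fun φ => g φ + g' φ) fun φ => h φ + h' φ := by
  refine ⟨h₁.1.add h₂.1, h₁.2.1.add h₂.2.1, ?_⟩
  rw [mean_add h₁.1 h₂.1, mean_add h₁.2.1 h₂.2.1]
  exact add_le_add h₁.2.2 h₂.2.2

lemma MeanLE.neg (h₁ : MeanLE p g h) : MeanLE p (fun φ => -h φ) fun φ => -g φ := by
  refine ⟨h₁.2.1.neg, h₁.1.neg, ?_⟩
  rw [mean_neg, mean_neg]
  exact neg_le_neg h₁.2.2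

lemma MeanLE.sum {ι : Type*} (s : Finset ι) {g h : ι → Ω → ℝ}
    (H : ∀ i ∈ s, MeanLE p (g i) (h i)) :
    MeanLE p (fun φ => ∑ i ∈ s, g i φ) fun φ => ∑ i ∈ s, h i φ := by
  refine ⟨.sum s fun i hi => (H i hi).1, .sum s fun i hi => (H i hi).2.1, ?_⟩
  rw [mean_sum s fun i hi => (H i hi).1, mean_sum s fun i hi => (H i hi).2.1]
  exact Finset.sum_le_sum fun i hi => (H i hi).2.2

lemma mean_mono (hg : HasMean p g) (hh : HasMean p h) (H : ∀ φ, g φ ≤ h φ) :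
    mean p g ≤ mean p h :=
  Summable.tsum_le_tsum (fun φ => mul_le_mul_of_nonneg_left (H φ) ENNReal.toReal_nonneg) hg hh

lemma toReal_le_one {β : Type*} (μ : PMF β) (b : β) : (μ b).toReal ≤ 1 :=
  ENNReal.toReal_le_of_le_ofReal zero_le_one (by simpa using μ.coe_le_one b)

/-- The law of total expectation for a randomized map into a finite type. -/
lemma sum_toReal_bind {α β : Type*} [Fintype β] (μ : PMF α) (κ : α → PMF β) (h : β → ℝ) :
    ∑ b, ((μ.bind κ) b).toReal * h b = ∑' a, (μ a).toReal * ∑ b, (κ a b).toReal * h b := by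
  have hs : ∀ b, Summable fun a => (μ a).toReal * ((κ a b).toReal * h b) := fun b =>
    HasMean.weight_mul (p := μ) (g := fun _ => h b) (G := fun a => (κ a b).toReal)
      ((summable_toReal μ).mul_right _) (fun _ => ENNReal.toReal_nonneg) fun a => toReal_le_one _ _
  simp only [Finset.mul_sum]
  rw [Summable.tsum_finsetSum fun b _ => hs b]
  refine Finset.sum_congr rfl fun b _ => ?_
  rw [PMF.bind_apply, ENNReal.tsum_toReal_eq fun a =>
    ENNReal.mul_ne_top (μ.apply_ne_top a) ((κ a).apply_ne_top b), ← tsum_mul_right]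
  simp only [ENNReal.toReal_mul, mul_assoc]

lemma sum_toReal_pure {β : Type*} [Fintype β] (b₀ : β) (h : β → ℝ) :
    ∑ b, ((PMF.pure b₀ : PMF β) b).toReal * h b = h b₀ := by
  classical
  rw [Finset.sum_eq_single b₀]
  · simp
  · intro b _ hb
    simp [PMF.pure_apply, hb]
  · simp

lemma sum_toReal_map {α β : Type*} [Fintype β] (μ : PMF α) (t : α → β) (h : β → ℝ) :
    ∑ b, ((μ.map t) b).toReal * h b = ∑' a, (μ a).toReal * h (t a) := by
  rw [← PMF.bind_pure_comp, sum_toReal_bind]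
  simp only [Function.comp_apply, sum_toReal_pure]

lemma sum_toReal_eq_one {β : Type*} [Fintype β] (μ : PMF β) : ∑ b, (μ b).toReal = 1 := by
  rw [← ENNReal.toReal_sum fun b _ => μ.apply_ne_top b, ← tsum_fintype (L := .unconditional _),
    μ.tsum_coe, ENNReal.toReal_one]

end Expectation

/-! ### Conditional expectations and marginal utilities -/

section Marginal

variable {E : Type u} {O : Type v}

/-- The value `G φ` depends on the states under `φ` of the items of `A` only. -/
def AdaptedTo {X : Type*} (A : Finset E) (G : (E → O) → X) : Prop :=
  ∀ φ φ', (∀ e ∈ A, φ e = φ' e) → G φ = G φ'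

lemma AdaptedTo.mono {X : Type*} {A B : Finset E} {G : (E → O) → X} (h : AdaptedTo A G)
    (hAB : A ⊆ B) : AdaptedTo B G := fun φ φ' H => h φ φ' fun e he => H e (hAB he)

lemma AdaptedTo.mul {A : Finset E} {G H : (E → O) → ℝ} (hG : AdaptedTo A G)
    (hH : AdaptedTo A H) : AdaptedTo A fun φ => G φ * H φ := fun φ φ' h => by
  simp only [hG φ φ' h, hH φ φ' h]

lemma prob_nonneg (p : PMF (E → O)) (ψ : PartialRealization E O) : 0 ≤ prob p ψ :=
  tsum_nonneg fun φ => by split_ifs <;> simp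

variable [DecidableEq E]

lemma observed_eq_iff {φ φ' : E → O} {A : Finset E} :
    observed φ A = observed φ' A ↔ ∀ e ∈ A, φ e = φ' e := by
  constructor
  · intro h e he
    simpa [observed, he] using congrFun h e
  · intro h
    funext e
    by_cases he : e ∈ A <;> simp [observed, he, h]

lemma adaptedTo_observed {X : Type*} (A : Finset E) (t : PartialRealization E O → X) :
    AdaptedTo A fun φ : E → O => t (observed φ A) := fun φ φ' h => by
  simp only [observed_eq_iff.2 h]

lemma consistent_observed_iff {φ φ' : E → O} {A : Finset E} :
    Consistent φ (observed φ' A) ↔ observed φ A = observed φ' A := by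
  rw [observed_eq_iff]
  constructor
  · intro h e he
    exact h e _ (by simp [observed, he])
  · intro h e o ho
    by_cases he : e ∈ A
    · simp only [observed, he, if_true, Option.some.injEq] at ho
      rw [h e he, ho]
    · simp [observed, he] at ho

lemma subrealization_observed (φ : E → O) {A B : Finset E} (h : A ⊆ B) :
    Subrealization (observed φ A) (observed φ B) := fun e o ho => by
  by_cases he : e ∈ A
  · simpa [observed, he, h he] using ho
  · simp [observed, he] at ho

lemma dom_observed [Fintype E] (φ : E → O) (A : Finset E) : dom (observed φ A) = A := by
  ext e
  by_cases he : e ∈ A <;> simp [dom, observed, he]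

variable [Fintype E] {p : PMF (E → O)} {f : Finset E → (E → O) → ℝ}

lemma marginal_of_prob_eq_zero {ψ : PartialRealization E O} (h : prob p ψ = 0) (e : E) :
    marginal p f e ψ = 0 := by
  simp [marginal, condExpectation, h]

/-- Adaptive monotonicity extends to partial realizations of probability zero, where the marginal
utility is `0` by the convention on division by zero. -/
lemma AdaptiveMonotone.marginal_nonneg (hm : AdaptiveMonotone p f) (e : E)
    (ψ : PartialRealization E O) : 0 ≤ marginal p f e ψ := by
  rcases (prob_nonneg p ψ).lt_or_eq with h | h
  · exact hm ψ h e
  · rw [marginal_of_prob_eq_zero h.symm]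

lemma marginal_of_mem_dom {ψ : PartialRealization E O} {e : E} (h : e ∈ dom ψ) :
    marginal p f e ψ = 0 := by
  simp [marginal, condExpectation, Finset.insert_eq_of_mem h]

lemma AdaptiveSubmodular.marginal_le (hs : AdaptiveSubmodular p f) (hm : AdaptiveMonotone p f)
    {ψ ψ' : PartialRealization E O} (h : Subrealization ψ ψ') (e : E) :
    marginal p f e ψ' ≤ marginal p f e ψ := by
  by_cases he : e ∈ dom ψ'
  · rw [marginal_of_mem_dom he]
    exact hm.marginal_nonneg e ψ
  rcases (prob_nonneg p ψ').lt_or_eq with h' | h'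
  · exact hs ψ ψ' h h' e he
  · rw [marginal_of_prob_eq_zero h'.symm]
    exact hm.marginal_nonneg e ψ

/-- On the event `observed Φ A = ψ` the conditional expectation integrates to the original one. -/
lemma tsum_fiber_mul_eq (p : PMF (E → O)) (A : Finset E) (φ₀ : E → O) (g : (E → O) → ℝ) :
    ∑' φ : {φ : E → O // observed φ A = observed φ₀ A}, (p φ).toReal * g φ =
      ∑' φ : {φ : E → O // observed φ A = observed φ₀ A},
        (p φ).toReal * condExpectation p (observed φ₀ A) g := by
  classical
  have hsub : ∀ a : (E → O) → ℝ,
      ∑' φ : {φ : E → O // observed φ A = observed φ₀ A}, a φ =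
        ∑' φ, if Consistent φ (observed φ₀ A) then a φ else 0 := fun a => by
    rw [show (∑' φ : {φ : E → O // observed φ A = observed φ₀ A}, a φ) =
      ∑' φ : ↑{φ : E → O | observed φ A = observed φ₀ A}, a φ from rfl, tsum_subtype]
    refine tsum_congr fun φ => ?_
    simp [Set.indicator_apply, consistent_observed_iff]
  rw [tsum_mul_right, hsub (fun φ => (p φ).toReal), hsub fun φ => (p φ).toReal * g φ]
  have hprob : prob p (observed φ₀ A) =
    ∑' φ, if Consistent φ (observed φ₀ A) then (p φ).toReal else 0 := by
    simp only [prob]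
  by_cases h0 : prob p (observed φ₀ A) = 0
  · -- Every realization in a null event has probability zero.
    have hz : ∀ φ, (if Consistent φ (observed φ₀ A) then (p φ).toReal else 0) = 0 := by
      have hs : Summable fun φ => if Consistent φ (observed φ₀ A) then (p φ).toReal else 0 := by
        refine Summable.of_nonneg_of_le (fun φ => ?_) (fun φ => ?_) (summable_toReal p)
        · split_ifs <;> simp
        · split_ifs <;> simp
      have := (hasSum_zero_iff_of_nonneg (fun φ => by split_ifs <;> simp)).1
        ((hprob.symm.trans h0) ▸ hs.hasSum)
      exact fun φ => congrFun this φ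
    rw [← hprob, h0, zero_mul]
    refine (tsum_congr fun φ => ?_).trans tsum_zero
    have := hz φ
    split_ifs at this ⊢
    · rw [this, zero_mul]
    · rfl
  · rw [← hprob, condExpectation, mul_div_cancel₀ _ h0]

/-- If `G` depends on the states of the items of `A` only, then adding `e` to `A` on the event
weighted by `G` increases the expected utility by the mean of the marginal utility. -/
lemma mean_weight_mul_marginal (hf : ∀ S, HasMean p (f S)) (hm : AdaptiveMonotone p f)
    {A : Finset E} (e : E) {G : (E → O) → ℝ} (hG : AdaptedTo A G) (h0 : ∀ φ, 0 ≤ G φ)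
    (h1 : ∀ φ, G φ ≤ 1) :
    HasMean p (fun φ => G φ * marginal p f e (observed φ A)) ∧
      mean p (fun φ => G φ * marginal p f e (observed φ A)) =
        mean p fun φ => G φ * (f (insert e A) φ - f A φ) := by
  -- Both series are summed over the events `observed Φ A = ψ`, on which `G` is constant. The one
  -- with the marginal utilities converges because its terms are nonnegative.
  set a : (E → O) → ℝ := fun φ => (p φ).toReal * (G φ * (f (insert e A) φ - f A φ)) with ha
  set b : (E → O) → ℝ := fun φ => (p φ).toReal * (G φ * marginal p f e (observed φ A)) with hb
  let ev := Equiv.sigmaFiberEquiv fun φ : E → O => observed φ A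
  have hfib : ∀ ψ, ∑' φ : {φ : E → O // observed φ A = ψ}, a φ =
      ∑' φ : {φ : E → O // observed φ A = ψ}, b φ := fun ψ => by
    by_cases hψ : ∃ φ₀ : E → O, observed φ₀ A = ψ
    · obtain ⟨φ₀, rfl⟩ := hψ
      have hGc : ∀ φ : {φ : E → O // observed φ A = observed φ₀ A}, G φ = G φ₀ := fun φ =>
        hG _ _ (observed_eq_iff.1 φ.2)
      have hA : ∀ φ : {φ : E → O // observed φ A = observed φ₀ A},
          a φ = G φ₀ * ((p φ).toReal * (f (insert e A) φ - f A φ)) := fun φ => by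
        simp only [ha, hGc φ]; ring
      have hB : ∀ φ : {φ : E → O // observed φ A = observed φ₀ A},
          b φ = G φ₀ * ((p φ).toReal * marginal p f e (observed φ₀ A)) := fun φ => by
        simp only [hb, hGc φ, φ.2]; ring
      rw [tsum_congr hA, tsum_congr hB, tsum_mul_left, tsum_mul_left,
        tsum_fiber_mul_eq p A φ₀ fun φ => f (insert e A) φ - f A φ]
      simp only [marginal, dom_observed]
    · have : IsEmpty {φ : E → O // observed φ A = ψ} := ⟨fun φ => hψ ⟨φ, φ.2⟩⟩
      simp
  have hsa : Summable a := ((hf (insert e A)).sub (hf A)).weight_mul h0 h1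
  have hsa' : Summable (a ∘ ev) := ev.summable_iff.2 hsa
  have hsb' : Summable (b ∘ ev) := by
    refine (summable_sigma_of_nonneg fun x => ?_).2 ⟨fun ψ => ?_, ?_⟩
    · exact mul_nonneg ENNReal.toReal_nonneg (mul_nonneg (h0 _) (hm.marginal_nonneg _ _))
    · have hc : HasMean p fun _ => marginal p f e ψ := (summable_toReal p).mul_right _
      have := (hc.weight_mul h0 h1).subtype {φ : E → O | observed φ A = ψ}
      refine this.congr fun φ => ?_
      have hφ : observed φ.1 A = ψ := φ.2
      simp [ev, hb, hφ]
    · exact hsa'.sigma.congr fun ψ => hfib ψ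
  have hsb : Summable b := ev.summable_iff.1 hsb'
  refine ⟨hsb, ?_⟩
  change ∑' φ, b φ = ∑' φ, a φ
  rw [← ev.tsum_eq a, ← ev.tsum_eq b]
  exact hsb'.tsum_sigma.trans ((tsum_congr hfib).symm.trans hsa'.tsum_sigma.symm)

lemma hasMean_marginal (hf : ∀ S, HasMean p (f S)) (hm : AdaptiveMonotone p f) (e : E)
    (A : Finset E) :
    HasMean p fun φ => marginal p f e (observed φ A) := by
  simpa using (mean_weight_mul_marginal hf hm (A := A) e (G := fun _ => 1) (fun _ _ _ => rfl)
    (fun _ => zero_le_one) fun _ => le_rfl).1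

end Marginal

/-! ### The law of the set selected by a policy -/

section Law

variable {E : Type u} {O : Type v} [DecidableEq E]

/-- The law of the item selected in round `r` when the current partial realization is `ψ`. -/
def Policy.decision (π : Policy E O) (oracle : E → PartialRealization E O → ℝ) (r : ℕ)
    (ψ : PartialRealization E O) : PMF (Option E) :=
  ((π.step r ψ).run oracle).map Prod.fst

/-- The law of the set selected in the first `r` rounds under the realization `φ`. -/
def Policy.law (π : Policy E O) (oracle : E → PartialRealization E O → ℝ) (φ : E → O) (r : ℕ) :
    PMF (Finset E) :=
  (π.runRounds oracle φ r).map Prod.fst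

lemma Policy.law_zero (π : Policy E O) (oracle : E → PartialRealization E O → ℝ) (φ : E → O) :
    π.law oracle φ 0 = PMF.pure ∅ := by
  simp [Policy.law, Policy.runRounds, PMF.pure_map]

lemma Policy.law_succ (π : Policy E O) (oracle : E → PartialRealization E O → ℝ) (φ : E → O)
    (r : ℕ) :
    π.law oracle φ (r + 1) = (π.law oracle φ r).bind fun A =>
      (π.decision oracle r (observed φ A)).map fun o => A ∪ o.toFinset := by
  simp only [Policy.law, Policy.runRounds, Policy.decision, PMF.map_bind, PMF.bind_map,
    PMF.map_comp, Function.comp_def]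

/-- The probability that `A` is selected depends on the states of the items of `A` only, because
the policy observes nothing else on the way to `A`. -/
lemma Policy.adaptedTo_law (π : Policy E O) (oracle : E → PartialRealization E O → ℝ) (r : ℕ)
    (A : Finset E) : AdaptedTo A fun φ : E → O => π.law oracle φ r A := by
  induction r generalizing A with
  | zero => exact fun φ φ' _ => by simp only [Policy.law_zero]
  | succ r ih =>
    intro φ φ' h
    simp only [Policy.law_succ, PMF.bind_apply]
    refine tsum_congr fun B => ?_
    by_cases hB : B ⊆ A
    · have hlaw : π.law oracle φ r B = π.law oracle φ' r B := (ih B).mono hB φ φ' h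
      rw [hlaw, observed_eq_iff.2 fun e he => h e (hB he)]
    · have hz : ∀ μ : PMF (Option E), (μ.map fun o => B ∪ o.toFinset) A = 0 := fun μ => by
        rw [PMF.apply_eq_zero_iff, PMF.mem_support_map_iff]
        rintro ⟨o, -, ho⟩
        exact hB (ho ▸ Finset.subset_union_left)
      rw [hz, hz, mul_zero, mul_zero]

lemma union_toFinset_some (A : Finset E) (e : E) : A ∪ (some e).toFinset = insert e A := by
  ext x; simp

variable [Fintype E]

lemma Policy.sum_law_zero (π : Policy E O) (oracle : E → PartialRealization E O → ℝ)
    (φ : E → O) (h : Finset E → ℝ) : ∑ A, (π.law oracle φ 0 A).toReal * h A = h ∅ := by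
  rw [π.law_zero, sum_toReal_pure]

lemma Policy.sum_law_succ (π : Policy E O) (oracle : E → PartialRealization E O → ℝ)
    (φ : E → O) (r : ℕ) (h : Finset E → ℝ) :
    ∑ A, (π.law oracle φ (r + 1) A).toReal * h A =
      ∑ A, (π.law oracle φ r A).toReal *
        ∑ o, (π.decision oracle r (observed φ A) o).toReal * h (A ∪ o.toFinset) := by
  rw [π.law_succ, sum_toReal_bind, tsum_fintype]
  simp only [sum_toReal_map, tsum_fintype]

/-- The expected marginal utility of the item selected in round `r` at `ψ`. -/
def Policy.gain (π : Policy E O) (oracle : E → PartialRealization E O → ℝ) (r : ℕ)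
    (ψ : PartialRealization E O) : ℝ :=
  ∑ o : Option E, (π.decision oracle r ψ o).toReal * o.elim 0 fun e => oracle e ψ

/-- A potential `H` that does not increase on average when an item is added does not increase on
average along the execution of a policy. -/
lemma Policy.meanLE_law {p : PMF (E → O)} (π : Policy E O)
    (oracle : E → PartialRealization E O → ℝ) {H : Finset E → (E → O) → ℝ}
    (h0 : HasMean p (H ∅))
    (hstep : ∀ A e (G : (E → O) → ℝ), AdaptedTo A G → (∀ φ, 0 ≤ G φ) → (∀ φ, G φ ≤ 1) →
      HasMean p (H A) ∧
      MeanLE p (fun φ => G φ * H (insert e A) φ) fun φ => G φ * H A φ) (r : ℕ) :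
    MeanLE p (fun φ => ∑ A, (π.law oracle φ r A).toReal * H A φ) (H ∅) := by
  induction r with
  | zero =>
    simp only [Policy.sum_law_zero]
    exact h0.meanLE_self
  | succ r ih =>
    refine MeanLE.trans ?_ ih
    have key : MeanLE p
        (fun φ => ∑ A, ∑ o, ((π.law oracle φ r A).toReal *
          (π.decision oracle r (observed φ A) o).toReal) * H (A ∪ o.toFinset) φ)
        (fun φ => ∑ A, ∑ o, ((π.law oracle φ r A).toReal *
          (π.decision oracle r (observed φ A) o).toReal) * H A φ) := by
      refine MeanLE.sum _ fun A _ => MeanLE.sum _ fun o _ => ?_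
      have hG : AdaptedTo A fun φ : E → O => (π.law oracle φ r A).toReal *
          (π.decision oracle r (observed φ A) o).toReal :=
        AdaptedTo.mul (fun φ φ' h => by simp only [π.adaptedTo_law oracle r A φ φ' h])
          (adaptedTo_observed A fun ψ => (π.decision oracle r ψ o).toReal)
      have hG0 : ∀ φ : E → O, 0 ≤ (π.law oracle φ r A).toReal *
          (π.decision oracle r (observed φ A) o).toReal := fun φ =>
        mul_nonneg ENNReal.toReal_nonneg ENNReal.toReal_nonneg
      have hG1 : ∀ φ : E → O, (π.law oracle φ r A).toReal *
          (π.decision oracle r (observed φ A) o).toReal ≤ 1 := fun φ =>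
        mul_le_one₀ (toReal_le_one _ _) ENNReal.toReal_nonneg (toReal_le_one _ _)
      cases o with
      | none =>
        simp only [Option.toFinset_none, Finset.union_empty]
        rcases isEmpty_or_nonempty E with hE | ⟨⟨e⟩⟩
        · rw [Finset.eq_empty_of_isEmpty A] at *
          exact (h0.weight_mul hG0 hG1).meanLE_self
        · exact ((hstep A e _ hG hG0 hG1).1.weight_mul hG0 hG1).meanLE_self
      | some e =>
        simp only [union_toFinset_some]
        exact (hstep A e _ hG hG0 hG1).2
    simp only [Policy.sum_law_succ]
    simpa only [mul_assoc, ← Finset.mul_sum, ← Finset.sum_mul, sum_toReal_eq_one, one_mul]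
      using key

end Law

/-! ### Comparing policies -/

section Compare

variable {E : Type u} {O : Type v} [DecidableEq E] [Fintype E] {p : PMF (E → O)}
  {f : Finset E → (E → O) → ℝ}

lemma meanLE_insert (hf : ∀ S, HasMean p (f S)) (hm : AdaptiveMonotone p f) {A : Finset E}
    (e : E) {G : (E → O) → ℝ} (hG : AdaptedTo A G) (h0 : ∀ φ, 0 ≤ G φ) (h1 : ∀ φ, G φ ≤ 1) :
    MeanLE p (fun φ => G φ * f A φ) fun φ => G φ * f (insert e A) φ := by
  obtain ⟨-, h⟩ := mean_weight_mul_marginal hf hm e hG h0 h1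
  have hA := (hf A).weight_mul h0 h1
  have hd := ((hf (insert e A)).sub (hf A)).weight_mul h0 h1
  have hnn : 0 ≤ mean p fun φ => G φ * marginal p f e (observed φ A) :=
    tsum_nonneg fun φ => mul_nonneg ENNReal.toReal_nonneg
      (mul_nonneg (h0 φ) (hm.marginal_nonneg _ _))
  have := mean_add hA hd
  simp only [← mul_add, add_sub_cancel] at this
  exact ⟨hA, (hf _).weight_mul h0 h1, by linarith⟩

/-- By adaptive submodularity, the marginal utility at an earlier observation bounds the gain. -/
lemma meanLE_insert_marginal (hf : ∀ S, HasMean p (f S)) (hs : AdaptiveSubmodular p f)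
    (hm : AdaptiveMonotone p f) {A B : Finset E} (hBA : B ⊆ A) (e : E) {G : (E → O) → ℝ}
    (hG : AdaptedTo A G) (h0 : ∀ φ, 0 ≤ G φ) (h1 : ∀ φ, G φ ≤ 1) :
    MeanLE p (fun φ => G φ * f (insert e A) φ)
      fun φ => G φ * (f A φ + marginal p f e (observed φ B)) := by
  obtain ⟨hi, h⟩ := mean_weight_mul_marginal hf hm e hG h0 h1
  have hA := (hf A).weight_mul h0 h1
  have hd := ((hf (insert e A)).sub (hf A)).weight_mul h0 h1
  have hB := (hasMean_marginal hf hm e B).weight_mul h0 h1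
  have hle : mean p (fun φ => G φ * marginal p f e (observed φ A)) ≤
      mean p fun φ => G φ * marginal p f e (observed φ B) :=
    mean_mono hi hB fun φ => mul_le_mul_of_nonneg_left
      (hs.marginal_le hm (subrealization_observed φ hBA) e) (h0 φ)
  have e₁ := mean_add hA hd
  have e₂ := mean_add hA hB
  simp only [← mul_add, add_sub_cancel] at e₁ e₂
  exact ⟨(hf _).weight_mul h0 h1, ((hf A).add (hasMean_marginal hf hm e B)).weight_mul h0 h1,
    by linarith⟩

/-- The expected utility of the set selected by `π` in the first `r` rounds. -/
def Policy.value (π : Policy E O) (p : PMF (E → O)) (f : Finset E → (E → O) → ℝ) (r : ℕ) : ℝ :=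
  mean p fun φ => ∑ A, (π.law (marginal p f) φ r A).toReal * f A φ

lemma Policy.hasMean_sum_law (π : Policy E O) (r : ℕ) {g : Finset E → (E → O) → ℝ}
    (hg : ∀ A, HasMean p (g A)) :
    HasMean p fun φ => ∑ A, (π.law (marginal p f) φ r A).toReal * g A φ :=
  .sum _ fun A _ => (hg A).weight_mul (fun _ => ENNReal.toReal_nonneg) fun _ => toReal_le_one _ _

lemma Policy.hasMean_gain (π : Policy E O) (hf : ∀ S, HasMean p (f S))
    (hm : AdaptiveMonotone p f) (r : ℕ) (A : Finset E) :
    HasMean p fun φ => π.gain (marginal p f) r (observed φ A) := by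
  refine HasMean.sum _ fun o _ => HasMean.weight_mul ?_ (fun _ => ENNReal.toReal_nonneg)
    fun _ => toReal_le_one _ _
  cases o with
  | none => simp [HasMean, summable_zero]
  | some e => exact hasMean_marginal hf hm e A

lemma Policy.value_succ (π : Policy E O) (hf : ∀ S, HasMean p (f S))
    (hm : AdaptiveMonotone p f) (r : ℕ) :
    π.value p f (r + 1) = π.value p f r + mean p fun φ => ∑ A,
      (π.law (marginal p f) φ r A).toReal * π.gain (marginal p f) r (observed φ A) := by
  rw [Policy.value, Policy.value, ← mean_add (π.hasMean_sum_law r hf)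
    (π.hasMean_sum_law r (π.hasMean_gain hf hm r))]
  simp only [Policy.sum_law_succ]
  set w : Finset E → Option E → (E → O) → ℝ := fun A o φ =>
    (π.law (marginal p f) φ r A).toReal *
      (π.decision (marginal p f) r (observed φ A) o).toReal with hw
  have hw0 : ∀ A o φ, 0 ≤ w A o φ := fun A o φ =>
    mul_nonneg ENNReal.toReal_nonneg ENNReal.toReal_nonneg
  have hw1 : ∀ A o φ, w A o φ ≤ 1 := fun A o φ =>
    mul_le_one₀ (toReal_le_one _ _) ENNReal.toReal_nonneg (toReal_le_one _ _)
  have hwa : ∀ A o, AdaptedTo A (w A o) := fun A o =>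
    AdaptedTo.mul (fun φ φ' h => by simp only [π.adaptedTo_law _ r A φ φ' h])
      (adaptedTo_observed A fun ψ => (π.decision (marginal p f) r ψ o).toReal)
  have e₁ : ∀ φ : E → O, ∑ A, (π.law (marginal p f) φ r A).toReal *
      ∑ o, (π.decision (marginal p f) r (observed φ A) o).toReal * f (A ∪ o.toFinset) φ =
      ∑ A, ∑ o, w A o φ * f (A ∪ o.toFinset) φ := fun φ => by
    simp only [hw, Finset.mul_sum, mul_assoc]
  have e₂ : ∀ φ : E → O, ∑ A, (π.law (marginal p f) φ r A).toReal * f A φ +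
      ∑ A, (π.law (marginal p f) φ r A).toReal * π.gain (marginal p f) r (observed φ A) =
      ∑ A, ∑ o : Option E, w A o φ *
        (f A φ + o.elim 0 fun e => marginal p f e (observed φ A)) := fun φ => by
    simp only [hw, Policy.gain, mul_assoc, ← Finset.mul_sum, mul_add, Finset.sum_add_distrib,
      ← Finset.sum_mul, sum_toReal_eq_one, one_mul]
  simp only [e₁, e₂]
  have i₂ : ∀ A (o : Option E), HasMean p fun φ =>
      f A φ + o.elim 0 fun e => marginal p f e (observed φ A) := fun A o => by
    cases o with
    | none => simpa using hf A
    | some e => exact (hf A).add (hasMean_marginal hf hm e A)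
  rw [mean_sum _ fun A _ => .sum _ fun o _ => (hf _).weight_mul (hw0 A o) (hw1 A o),
    mean_sum _ fun A _ => .sum _ fun o _ => (i₂ A o).weight_mul (hw0 A o) (hw1 A o)]
  refine Finset.sum_congr rfl fun A _ => ?_
  rw [mean_sum _ fun o _ => (hf _).weight_mul (hw0 A o) (hw1 A o),
    mean_sum _ fun o _ => (i₂ A o).weight_mul (hw0 A o) (hw1 A o)]
  refine Finset.sum_congr rfl fun o _ => ?_
  cases o with
  | none => simp
  | some e =>
    obtain ⟨hi, h⟩ := mean_weight_mul_marginal hf hm e (hwa A (some e)) (hw0 A _) (hw1 A _)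
    have hA := (hf A).weight_mul (hw0 A (some e)) (hw1 A (some e))
    have hd := ((hf (insert e A)).sub (hf A)).weight_mul (hw0 A (some e)) (hw1 A (some e))
    have e₁ := mean_add hA hd
    have e₂ := mean_add hA hi
    simp only [← mul_add, add_sub_cancel] at e₁ e₂
    simp only [union_toFinset_some, Option.elim_some]
    linarith

/-- Running `τ` for `r` rounds after `π`, without using what `π` observed, does not lose utility:
the two policies together achieve at least what `π` achieves. -/
lemma Policy.meanLE_union (π τ : Policy E O) (hf : ∀ S, HasMean p (f S))
    (hm : AdaptiveMonotone p f) (r j : ℕ) :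
    MeanLE p (fun φ => ∑ A, (π.law (marginal p f) φ j A).toReal * f A φ)
      fun φ => ∑ B, (τ.law (marginal p f) φ r B).toReal *
        ∑ A, (π.law (marginal p f) φ j A).toReal * f (A ∪ B) φ := by
  have key := τ.meanLE_law (marginal p f) (p := p)
    (H := fun B φ => -∑ A, (π.law (marginal p f) φ j A).toReal * f (A ∪ B) φ)
    (π.hasMean_sum_law j fun A => hf _).neg
    (fun B e G hG h0 h1 => by
      refine ⟨(π.hasMean_sum_law j fun A => hf _).neg, ?_⟩
      simp only [mul_neg]
      refine MeanLE.neg ?_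
      simp only [Finset.mul_sum, ← mul_assoc]
      refine MeanLE.sum _ fun A _ => ?_
      rw [Finset.union_insert]
      refine meanLE_insert hf hm e ?_
        (fun φ => mul_nonneg (h0 φ) ENNReal.toReal_nonneg)
        fun φ => mul_le_one₀ (h1 φ) ENNReal.toReal_nonneg (toReal_le_one _ _)
      exact (hG.mono Finset.subset_union_right).mul fun φ φ' h => by
        simp only [(π.adaptedTo_law (marginal p f) j A).mono Finset.subset_union_left φ φ' h]) r
  simpa using key.neg

/-- Running `π` after `τ`, without using what `τ` observed, gains at most the marginal utilities,
at the partial realization observed by `τ`, of the items that `π` selects. -/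
lemma Policy.meanLE_union_marginal (π τ : Policy E O) (hf : ∀ S, HasMean p (f S))
    (hs : AdaptiveSubmodular p f) (hm : AdaptiveMonotone p f) (r j : ℕ) :
    MeanLE p (fun φ => ∑ A, (π.law (marginal p f) φ j A).toReal *
        ∑ B, (τ.law (marginal p f) φ r B).toReal *
          (f (A ∪ B) φ - ∑ e ∈ A, marginal p f e (observed φ B)))
      fun φ => ∑ B, (τ.law (marginal p f) φ r B).toReal * f B φ := by
  have hd : ∀ A B : Finset E, HasMean p fun φ => ∑ e ∈ A, marginal p f e (observed φ B) :=
    fun A B => .sum _ fun e _ => hasMean_marginal hf hm e B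
  have key := π.meanLE_law (marginal p f) (p := p)
    (H := fun A φ => ∑ B, (τ.law (marginal p f) φ r B).toReal *
          (f (A ∪ B) φ - ∑ e ∈ A, marginal p f e (observed φ B)))
    (τ.hasMean_sum_law r fun B => (hf _).sub (hd _ _))
    (fun A e G hG h0 h1 => by
      refine ⟨τ.hasMean_sum_law r fun B => (hf _).sub (hd _ _), ?_⟩
      simp only [Finset.mul_sum, ← mul_assoc]
      refine MeanLE.sum _ fun B _ => ?_
      have w0 : ∀ φ, 0 ≤ G φ * (τ.law (marginal p f) φ r B).toReal :=
        fun φ => mul_nonneg (h0 φ) ENNReal.toReal_nonneg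
      have w1 : ∀ φ, G φ * (τ.law (marginal p f) φ r B).toReal ≤ 1 :=
        fun φ => mul_le_one₀ (h1 φ) ENNReal.toReal_nonneg (toReal_le_one _ _)
      by_cases he : e ∈ A
      · rw [Finset.insert_eq_of_mem he]
        exact (((hf _).sub (hd _ _)).weight_mul w0 w1).meanLE_self
      have := (meanLE_insert_marginal hf hs hm (B := B) (Finset.subset_union_right (s₁ := A)) e
        ((hG.mono Finset.subset_union_left).mul fun φ φ' h => by
          simp only [(τ.adaptedTo_law (marginal p f) r B).mono Finset.subset_union_right φ φ' h])
        w0 w1).add ((hd (insert e A) B).weight_mul w0 w1).neg.meanLE_self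
      simp only [← sub_eq_add_neg, ← mul_sub, Finset.sum_insert he, ← Finset.insert_union] at this
      simp only [Finset.sum_insert he]
      convert this using 3
      ring) j
  simpa using key

/-- If the expected gain of `τ` in round `r` is always at least a fraction `c` of the total
marginal utility of any `k` items, then round `r` closes a fraction `c` of the gap between `τ` and
any feasible policy. -/
lemma Policy.le_value_succ {π τ : Policy E O} (hf : ∀ S, HasMean p (f S))
    (hs : AdaptiveSubmodular p f) (hm : AdaptiveMonotone p f) {k : ℕ} {c : ℝ} (hc : 0 ≤ c)
    {r : ℕ} (hτ : ∀ ψ, ∀ M : Finset E, M.card ≤ k →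
      c * ∑ e ∈ M, marginal p f e ψ ≤ τ.gain (marginal p f) r ψ)
    (hπ : π.Feasible p f k) :
    τ.value p f r + c * (π.favg p f - τ.value p f r) ≤ τ.value p f (r + 1) := by
  have h₂ := (π.meanLE_union_marginal τ hf hs hm r π.rounds).2.2
  change _ ≤ τ.value p f r at h₂
  set W : Finset E → (E → O) → ℝ := fun B φ => (τ.law (marginal p f) φ r B).toReal with hW
  set K : Finset E → (E → O) → ℝ := fun A φ => (π.law (marginal p f) φ π.rounds A).toReal with hK
  have h₁ : π.favg p f ≤ mean p fun φ => ∑ B, W B φ * ∑ A, K A φ * f (A ∪ B) φ :=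
    (π.meanLE_union τ hf hm r π.rounds).2.2
  have hd : ∀ A B : Finset E, HasMean p fun φ => ∑ e ∈ A, marginal p f e (observed φ B) :=
    fun A B => .sum _ fun e _ => hasMean_marginal hf hm e B
  have i₁ : HasMean p fun φ => ∑ A, K A φ * ∑ B, W B φ *
      (f (A ∪ B) φ - ∑ e ∈ A, marginal p f e (observed φ B)) :=
    π.hasMean_sum_law _ fun A => τ.hasMean_sum_law _ fun B => (hf _).sub (hd A B)
  have i₂ : HasMean p fun φ => ∑ A, K A φ * ∑ B, W B φ *
      ∑ e ∈ A, marginal p f e (observed φ B) :=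
    π.hasMean_sum_law _ fun A => τ.hasMean_sum_law _ fun B => hd A B
  have i₃ : HasMean p fun φ => ∑ B, W B φ * τ.gain (marginal p f) r (observed φ B) :=
    τ.hasMean_sum_law _ fun B => τ.hasMean_gain hf hm r B
  have e₁ : ∀ φ, ∑ B, W B φ * ∑ A, K A φ * f (A ∪ B) φ =
      (∑ A, K A φ * ∑ B, W B φ * (f (A ∪ B) φ - ∑ e ∈ A, marginal p f e (observed φ B))) +
      ∑ A, K A φ * ∑ B, W B φ * ∑ e ∈ A, marginal p f e (observed φ B) := fun φ => by
    simp only [Finset.mul_sum, ← Finset.sum_add_distrib]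
    rw [Finset.sum_comm]
    refine Finset.sum_congr rfl fun A _ => Finset.sum_congr rfl fun B _ => ?_
    rw [← Finset.mul_sum, ← Finset.mul_sum]
    ring
  have h₃ : c * mean p (fun φ => ∑ A, K A φ * ∑ B, W B φ *
      ∑ e ∈ A, marginal p f e (observed φ B)) ≤
      mean p fun φ => ∑ B, W B φ * τ.gain (marginal p f) r (observed φ B) := by
    rw [← mean_const_mul]
    refine mean_mono (i₂.const_mul c) i₃ fun φ => ?_
    have hterm : ∀ A, K A φ * (c * ∑ B, W B φ * ∑ e ∈ A, marginal p f e (observed φ B)) ≤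
        K A φ * ∑ B, W B φ * τ.gain (marginal p f) r (observed φ B) := fun A => by
      by_cases hA : A ∈ (π.law (marginal p f) φ π.rounds).support
      · refine mul_le_mul_of_nonneg_left ?_ ENNReal.toReal_nonneg
        rw [Finset.mul_sum]
        refine Finset.sum_le_sum fun B _ => ?_
        rw [mul_left_comm]
        exact mul_le_mul_of_nonneg_left (hτ _ A (hπ φ A hA)) ENNReal.toReal_nonneg
      · have : K A φ = 0 := by
          simp only [hK]
          rw [(PMF.apply_eq_zero_iff _ _).2 hA, ENNReal.toReal_zero]
        rw [this, zero_mul, zero_mul]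
    rw [Finset.mul_sum]
    calc _ = ∑ A, K A φ * (c * ∑ B, W B φ * ∑ e ∈ A, marginal p f e (observed φ B)) :=
          Finset.sum_congr rfl fun A _ => by ring
      _ ≤ _ := Finset.sum_le_sum fun A _ => hterm A
      _ = _ := by rw [← Finset.sum_mul, sum_toReal_eq_one, one_mul]
  rw [τ.value_succ hf hm r]
  rw [funext e₁, mean_add i₁ i₂] at h₁
  have := mul_le_mul_of_nonneg_left (h₁.trans (add_le_add_left h₂ _)) hc
  linarith

/-- The gap to a feasible policy shrinks by a factor `1 - c` in each round. -/
lemma Policy.value_ge {π τ : Policy E O} (hf0 : ∀ S φ, 0 ≤ f S φ) (hf : ∀ S, HasMean p (f S))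
    (hs : AdaptiveSubmodular p f) (hm : AdaptiveMonotone p f) {k : ℕ} {c : ℝ} (hc : 0 ≤ c)
    (hc1 : c ≤ 1) (hτ : ∀ r ψ, ∀ M : Finset E, M.card ≤ k →
      c * ∑ e ∈ M, marginal p f e ψ ≤ τ.gain (marginal p f) r ψ)
    (hπ : π.Feasible p f k) (r : ℕ) :
    (1 - (1 - c) ^ r) * π.favg p f ≤ τ.value p f r := by
  induction r with
  | zero =>
    simp only [pow_zero, sub_self, zero_mul, Policy.value, Policy.sum_law_zero]
    exact tsum_nonneg fun φ => mul_nonneg ENNReal.toReal_nonneg (hf0 _ _)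
  | succ r ih =>
    have h := Policy.le_value_succ hf hs hm hc (hτ r) hπ
    have := mul_le_mul_of_nonneg_left ih (sub_nonneg.2 hc1)
    rw [pow_succ]
    linarith

end Compare

/-! ### Uniformly random sets of a fixed size -/

section Hypergeometric

variable {E : Type u}

lemma sum_powersetCard_map_perm [Fintype E] (m : ℕ) (σ : Equiv.Perm E) (g : Finset E → ℝ) :
    ∑ S ∈ Finset.powersetCard m Finset.univ, g (S.map σ.toEmbedding) =
      ∑ S ∈ Finset.powersetCard m Finset.univ, g S := by
  refine Finset.sum_equiv σ.finsetCongr (fun S => ?_) fun S _ => rfl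
  simp [Finset.mem_powersetCard]

variable [DecidableEq E]

lemma card_inter_map_swap {M : Finset E} {a b : E} (ha : a ∈ M) (hb : b ∈ M) (S : Finset E) :
    (S.map (Equiv.swap a b).toEmbedding ∩ M).card = (S ∩ M).card := by
  have hM : M.map (Equiv.swap a b).toEmbedding = M := by
    ext x
    simp only [Finset.mem_map_equiv, Equiv.symm_swap]
    rcases eq_or_ne x a with rfl | hxa
    · simp [ha, hb]
    rcases eq_or_ne x b with rfl | hxb
    · simp [ha, hb]
    · rw [Equiv.swap_apply_of_ne_of_ne hxa hxb]
  conv_lhs => rw [← hM]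
  rw [← Finset.map_inter, Finset.card_map]

variable [Fintype E]

lemma sum_card_inter_powersetCard (m : ℕ) (M : Finset E) (t : Finset E → ℝ) :
    ∑ S ∈ Finset.powersetCard m Finset.univ, ((S ∩ M).card : ℝ) * t S =
      ∑ a ∈ M, ∑ S ∈ Finset.powersetCard m Finset.univ, (if a ∈ S then t S else 0) := by
  rw [Finset.sum_comm]
  refine Finset.sum_congr rfl fun S _ => ?_
  rw [← Finset.sum_filter, Finset.sum_const, nsmul_eq_mul, Finset.inter_comm,
    Finset.filter_mem_eq_inter]

/-- If `F` is invariant under exchanging items of `M`, then all items of `M` contribute equally to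
the `F`-weighted number of items of `M` in a random set. -/
lemma card_mul_sum_mem (m : ℕ) (M : Finset E) (F : Finset E → ℝ)
    (hF : ∀ a ∈ M, ∀ b ∈ M, ∀ S : Finset E, F (S.map (Equiv.swap a b).toEmbedding) = F S)
    {a : E} (ha : a ∈ M) :
    (M.card : ℝ) * ∑ S ∈ Finset.powersetCard m Finset.univ, (if a ∈ S then F S else 0) =
      ∑ S ∈ Finset.powersetCard m Finset.univ, ((S ∩ M).card : ℝ) * F S := by
  have hsym : ∀ b ∈ M, ∑ S ∈ Finset.powersetCard m Finset.univ, (if b ∈ S then F S else 0) =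
      ∑ S ∈ Finset.powersetCard m Finset.univ, (if a ∈ S then F S else 0) := fun b hb => by
    rw [← sum_powersetCard_map_perm m (Equiv.swap a b) fun S => if b ∈ S then F S else 0]
    refine Finset.sum_congr rfl fun S _ => ?_
    rw [hF a ha b hb]
    congr 1
    simp only [Finset.mem_map_equiv, Equiv.symm_swap, Equiv.swap_apply_right]
  calc _ = ∑ b ∈ M, ∑ S ∈ Finset.powersetCard m Finset.univ, (if b ∈ S then F S else 0) := by
        rw [Finset.sum_congr rfl hsym, Finset.sum_const, nsmul_eq_mul]
    _ = _ := (sum_card_inter_powersetCard m M F).symm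

variable {m : ℕ} {M : Finset E}

/-- A given item belongs to a random `m`-element set with probability `m / n`. -/
lemma sum_mem_powersetCard (a : E) :
    (Fintype.card E : ℝ) * ∑ S ∈ Finset.powersetCard m Finset.univ, (if a ∈ S then (1 : ℝ) else 0) =
      m * (Finset.powersetCard m (Finset.univ : Finset E)).card := by
  have := card_mul_sum_mem m Finset.univ (fun _ => 1) (fun _ _ _ _ _ => rfl) (Finset.mem_univ a)
  rw [Finset.card_univ] at this
  rw [this, mul_comm (m : ℝ), ← nsmul_eq_mul, ← Finset.sum_const]
  refine Finset.sum_congr rfl fun S hS => ?_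
  rw [Finset.inter_univ, (Finset.mem_powersetCard.1 hS).2, mul_one]

/-- The mean of the hypergeometric distribution. -/
lemma sum_card_inter :
    (Fintype.card E : ℝ) * ∑ S ∈ Finset.powersetCard m Finset.univ, ((S ∩ M).card : ℝ) =
      M.card * m * (Finset.powersetCard m (Finset.univ : Finset E)).card := by
  have := sum_card_inter_powersetCard m M fun _ => 1
  simp only [mul_one] at this
  rw [this, Finset.mul_sum, Finset.sum_congr rfl fun a _ => sum_mem_powersetCard a,
    Finset.sum_const, nsmul_eq_mul, mul_assoc]

/-- Distinct items are negatively correlated: `(m - 1) / (n - 1) ≤ m / n`. -/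
lemma sum_mem_mem_le {a b : E} (hab : a ≠ b) :
    (Fintype.card E : ℝ) * ∑ S ∈ Finset.powersetCard m Finset.univ,
        (if a ∈ S then (if b ∈ S then (1 : ℝ) else 0) else 0) ≤
      m * ∑ S ∈ Finset.powersetCard m Finset.univ, (if b ∈ S then (1 : ℝ) else 0) := by
  have h := card_mul_sum_mem m (Finset.univ.erase b) (fun S => if b ∈ S then (1 : ℝ) else 0)
    (fun x hx y hy S => by
      congr 1
      simp only [Finset.mem_map_equiv, Equiv.symm_swap]
      rw [Equiv.swap_apply_of_ne_of_ne (Finset.ne_of_mem_erase hx).symm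
        (Finset.ne_of_mem_erase hy).symm]) (Finset.mem_erase.2 ⟨hab, Finset.mem_univ a⟩)
  have hcard : ((Finset.univ.erase b).card : ℝ) = Fintype.card E - 1 := by
    rw [Finset.card_erase_of_mem (Finset.mem_univ b), Finset.card_univ,
      Nat.cast_sub (Fintype.card_pos_iff.2 ⟨b⟩), Nat.cast_one]
  have hr : ∑ S ∈ Finset.powersetCard m Finset.univ,
      ((S ∩ Finset.univ.erase b).card : ℝ) * (if b ∈ S then (1 : ℝ) else 0) =
      (m - 1) * ∑ S ∈ Finset.powersetCard m Finset.univ, (if b ∈ S then (1 : ℝ) else 0) := by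
    rw [Finset.mul_sum]
    refine Finset.sum_congr rfl fun S hS => ?_
    split_ifs with hb
    · have : S ∩ Finset.univ.erase b = S.erase b := by ext x; simp [and_comm]
      rw [this, Finset.card_erase_of_mem hb, Nat.cast_sub (Finset.card_pos.2 ⟨b, hb⟩),
        (Finset.mem_powersetCard.1 hS).2, Nat.cast_one]
    · simp
  rw [hcard, hr] at h
  set X := ∑ S ∈ Finset.powersetCard m Finset.univ,
        (if a ∈ S then (if b ∈ S then (1 : ℝ) else 0) else 0)
  have hXY : X ≤ ∑ S ∈ Finset.powersetCard m Finset.univ, (if b ∈ S then (1 : ℝ) else 0) := by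
    refine Finset.sum_le_sum fun S _ => ?_
    split_ifs <;> simp
  linarith

/-- The variance of the number of items of `M` in a random set is at most its mean. -/
lemma sum_sq_card_inter_sub_le (hn : 0 < Fintype.card E) {s : ℝ}
    (hs : s = M.card * m / Fintype.card E) :
    ∑ S ∈ Finset.powersetCard m Finset.univ, (((S ∩ M).card : ℝ) - s) ^ 2 ≤
      s * (Finset.powersetCard m (Finset.univ : Finset E)).card := by
  set P := Finset.powersetCard m (Finset.univ : Finset E) with hP
  have hn' : (0 : ℝ) < Fintype.card E := Nat.cast_pos.2 hn
  set n : ℝ := (Fintype.card E : ℝ)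
  have hmean : ∑ S ∈ P, ((S ∩ M).card : ℝ) = s * P.card := by
    have := sum_card_inter (m := m) (M := M)
    rw [← hP] at this
    rw [hs, div_mul_eq_mul_div, eq_div_iff hn'.ne', ← this, mul_comm]
  have hone : ∀ b : E, ∑ S ∈ P, (if b ∈ S then (1 : ℝ) else 0) = m / n * P.card := fun b => by
    have := sum_mem_powersetCard (m := m) b
    rw [← hP] at this
    rw [div_mul_eq_mul_div, eq_div_iff hn'.ne', ← this, mul_comm]
  have hpair : ∀ b ∈ M, ∑ S ∈ P, ((S ∩ M).card : ℝ) * (if b ∈ S then (1 : ℝ) else 0) ≤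
      m / n * P.card + s * (m / n * P.card) := fun b hb => by
    rw [sum_card_inter_powersetCard, ← Finset.add_sum_erase _ _ hb]
    refine add_le_add ?_ ?_
    · rw [← hone b]
      exact Finset.sum_le_sum fun S _ => by split_ifs <;> simp
    · calc _ ≤ ∑ a ∈ M.erase b, m / n * (m / n * P.card) := by
            refine Finset.sum_le_sum fun a ha => ?_
            have := sum_mem_mem_le (m := m) (Finset.ne_of_mem_erase ha)
            rw [← hP, hone b] at this
            rw [div_mul_eq_mul_div (m : ℝ) n (_ * _), le_div_iff₀ hn', mul_comm]
            exact this
        _ ≤ ∑ a ∈ M, m / n * (m / n * P.card) :=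
            Finset.sum_le_sum_of_subset_of_nonneg (Finset.erase_subset _ _)
              fun _ _ _ => by positivity
        _ = _ := by
            rw [Finset.sum_const, nsmul_eq_mul, hs]
            ring
  have hsq : ∑ S ∈ P, ((S ∩ M).card : ℝ) ^ 2 ≤ s * P.card + s ^ 2 * P.card := by
    calc _ = ∑ S ∈ P, ((S ∩ M).card : ℝ) * (S ∩ M).card := by simp only [sq]
      _ = ∑ b ∈ M, ∑ S ∈ P, ((S ∩ M).card : ℝ) * (if b ∈ S then (1 : ℝ) else 0) := by
          rw [sum_card_inter_powersetCard]
          simp only [hP, mul_ite, mul_one, mul_zero]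
      _ ≤ ∑ b ∈ M, (m / n * P.card + s * (m / n * P.card)) := Finset.sum_le_sum hpair
      _ = _ := by
          rw [Finset.sum_const, nsmul_eq_mul, hs]
          ring
  have hexp : ∑ S ∈ P, (((S ∩ M).card : ℝ) - s) ^ 2 =
      ∑ S ∈ P, ((S ∩ M).card : ℝ) ^ 2 - 2 * s * ∑ S ∈ P, ((S ∩ M).card : ℝ) + s ^ 2 * P.card := by
    rw [Finset.mul_sum, ← Finset.sum_sub_distrib, mul_comm _ (P.card : ℝ), ← nsmul_eq_mul,
      ← Finset.sum_const, ← Finset.sum_add_distrib]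
    exact Finset.sum_congr rfl fun S _ => by ring
  rw [hexp, hmean]
  linarith

/-- A quadratic lower bound for the truncated number `min (N / s) 1`. -/
lemma quadratic_le_div_max {N s ε : ℝ} (hs : 0 < s) (hε : 0 < ε) :
    1 - ε / 2 - (1 - N / s) / 2 - (N - s) ^ 2 / (8 * ε * s ^ 2) ≤ N / max s N := by
  set x := N / s with hx
  have hN : N = x * s := by rw [hx, div_mul_cancel₀ _ hs.ne']
  have hq : (N - s) ^ 2 / (8 * ε * s ^ 2) = (1 - x) ^ 2 / (8 * ε) := by
    rw [hN]
    field_simp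
    ring
  -- The arithmetic-geometric mean inequality `|1 - x| ≤ ε + (1 - x)² / (4 ε)`.
  have hamgm : |1 - x| / 2 ≤ ε / 2 + (1 - x) ^ 2 / (8 * ε) := by
    have h1 : 0 ≤ (|1 - x| - 2 * ε) ^ 2 / (8 * ε) := by positivity
    have h2 : (|1 - x| - 2 * ε) ^ 2 / (8 * ε) = (1 - x) ^ 2 / (8 * ε) - |1 - x| / 2 + ε / 2 := by
      rw [sub_sq, sq_abs]
      field_simp
      ring
    linarith
  have hmin : N / max s N = min x 1 := by
    rcases le_total N s with h | h
    · rw [max_eq_left h, min_eq_left ((div_le_one hs).2 h)]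
    · rw [max_eq_right h, min_eq_right ((one_le_div hs).2 h), div_self (hs.trans_le h).ne']
  rw [hmin, hq]
  rcases le_total x 1 with h | h
  · rw [min_eq_left h]
    rw [abs_of_nonneg (by linarith)] at hamgm
    linarith
  · rw [min_eq_right h]
    rw [abs_of_nonpos (by linarith)] at hamgm
    linarith

/-- If the mean `s` of the number `N` of items of `M` in a random set is at least `1 / (4 ε²)`, then
`𝔼[min (N / s) 1] ≥ 1 - ε`. No condition on `s` is needed if the random set is everything. -/
lemma one_sub_le_sum_div_max (hn : 0 < Fintype.card E) {s ε : ℝ}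
    (hs : s = M.card * m / Fintype.card E) (hs0 : 0 < s) (hε : 0 < ε)
    (h : m = Fintype.card E ∨ 1 ≤ 4 * ε ^ 2 * s) :
    (1 - ε) * (Finset.powersetCard m (Finset.univ : Finset E)).card ≤
      ∑ S ∈ Finset.powersetCard m Finset.univ, ((S ∩ M).card : ℝ) / max s (S ∩ M).card := by
  have hn' : (0 : ℝ) < Fintype.card E := Nat.cast_pos.2 hn
  set P := Finset.powersetCard m (Finset.univ : Finset E) with hP
  rcases h with h | h
  · have hval : ∀ S ∈ P, ((S ∩ M).card : ℝ) / max s (S ∩ M).card = 1 := fun S hS => by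
      have hSu : S = Finset.univ :=
        Finset.eq_univ_of_card S ((Finset.mem_powersetCard.1 hS).2.trans h)
      have : s = M.card := by rw [hs, h, mul_div_cancel_right₀ _ hn'.ne']
      rw [hSu, Finset.univ_inter, ← this, max_self, div_self hs0.ne']
    rw [Finset.sum_congr rfl hval, Finset.sum_const, nsmul_eq_mul, mul_one]
    exact mul_le_of_le_one_left (Nat.cast_nonneg _) (by linarith)
  · have hmean : ∑ S ∈ P, ((S ∩ M).card : ℝ) = s * P.card := by
      have := sum_card_inter (m := m) (M := M)
      rw [← hP] at this
      rw [hs, div_mul_eq_mul_div, eq_div_iff hn'.ne', ← this, mul_comm]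
    have hvar := sum_sq_card_inter_sub_le hn hs
    rw [← hP] at hvar
    refine le_trans ?_ (Finset.sum_le_sum fun S _ => quadratic_le_div_max hs0 hε)
    have hsum : ∑ S ∈ P, (1 - ε / 2 - (1 - ((S ∩ M).card : ℝ) / s) / 2 -
        (((S ∩ M).card : ℝ) - s) ^ 2 / (8 * ε * s ^ 2)) =
        (1 - ε / 2) * P.card -
          (∑ S ∈ P, (((S ∩ M).card : ℝ) - s) ^ 2) / (8 * ε * s ^ 2) := by
      have h0 : ∑ S ∈ P, (1 - ((S ∩ M).card : ℝ) / s) / 2 = 0 := by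
        rw [← Finset.sum_div, Finset.sum_sub_distrib, ← Finset.sum_div, hmean,
          mul_div_cancel_left₀ _ hs0.ne']
        simp
      rw [Finset.sum_sub_distrib, Finset.sum_sub_distrib, h0, Finset.sum_const, nsmul_eq_mul,
        ← Finset.sum_div]
      ring
    rw [hsum]
    have hb : (∑ S ∈ P, (((S ∩ M).card : ℝ) - s) ^ 2) / (8 * ε * s ^ 2) ≤ ε / 2 * P.card := by
      rw [div_le_iff₀ (by positivity)]
      refine hvar.trans ?_
      have : s * P.card * 1 ≤ s * P.card * (4 * ε ^ 2 * s) :=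
        mul_le_mul_of_nonneg_left h (by positivity)
      linarith
    linarith

/-- The expectation over the random set `S` of the total weight of `S ∩ M`, divided by `max s N`
where `N` is the number of its items: by symmetry, each item of `M` has the same share in it. -/
lemma le_sum_sample (hn : 0 < Fintype.card E) {s ε : ℝ} {k : ℕ}
    (hk : M.card = k) (hs : s = k * m / Fintype.card E) (hs0 : 0 < s) (hε : 0 < ε)
    (h : m = Fintype.card E ∨ 1 ≤ 4 * ε ^ 2 * s) {w : E → ℝ} (hw : ∀ e, 0 ≤ w e) :
    (1 - ε) / k * (∑ e ∈ M, w e) * (Finset.powersetCard m (Finset.univ : Finset E)).card ≤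
      ∑ S ∈ Finset.powersetCard m Finset.univ, (∑ e ∈ S ∩ M, w e) / max s (S ∩ M).card := by
  subst hk
  set P := Finset.powersetCard m (Finset.univ : Finset E) with hP
  set g : Finset E → ℝ := fun S => 1 / max s (S ∩ M).card with hg
  have hswap : ∑ S ∈ P, (∑ e ∈ S ∩ M, w e) / max s (S ∩ M).card =
      ∑ e ∈ M, w e * ∑ S ∈ P, (if e ∈ S then g S else 0) := by
    simp only [Finset.mul_sum]
    rw [Finset.sum_comm]
    refine Finset.sum_congr rfl fun S _ => ?_
    rw [div_eq_mul_one_div, Finset.sum_mul, Finset.inter_comm, ← Finset.filter_mem_eq_inter,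
      Finset.sum_filter, Finset.filter_mem_eq_inter, Finset.inter_comm]
    exact Finset.sum_congr rfl fun e _ => by split_ifs <;> simp [hg]
  rw [hswap]
  have hb := one_sub_le_sum_div_max hn hs hs0 hε h
  rw [Finset.mul_sum, Finset.sum_mul]
  refine Finset.sum_le_sum fun e he => ?_
  have hM : (0 : ℝ) < M.card := Nat.cast_pos.2 (Finset.card_pos.2 ⟨e, he⟩)
  have hsym := card_mul_sum_mem m M g
    (fun a ha b hb S => by simp only [hg, card_inter_map_swap ha hb]) he
  simp only [hg, mul_one_div] at hsym
  rw [← hsym] at hb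
  calc _ = w e * ((1 - ε) * P.card / M.card) := by ring
    _ ≤ _ := by
        refine mul_le_mul_of_nonneg_left ?_ (hw e)
        rw [div_le_iff₀ hM, mul_comm (Finset.sum _ _)]
        exact hb

end Hypergeometric

/-! ### The random rank -/

section Rank

lemma ceilUniform_succ_toReal {s : ℝ} (hs : 0 < s) (i : ℕ) :
    (ceilUniform s (i + 1)).toReal = (min s (i + 1 : ℕ) - min s i) / s := by
  have hpre : (fun d : ℝ => ⌈d⌉₊) ⁻¹' {i + 1} = Set.Ioc (i : ℝ) (i + 1 : ℕ) := by
    rw [Nat.preimage_ceil_of_ne_zero (Nat.succ_ne_zero i)]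
    simp
  rw [ceilUniform, dif_pos hs, Measure.toPMF_apply,
    Measure.map_apply Nat.measurable_ceil (measurableSet_singleton _), hpre,
    cond_apply measurableSet_Ioc, Set.Ioc_inter_Ioc, Real.volume_Ioc, Real.volume_Ioc,
    ENNReal.toReal_mul, ENNReal.toReal_inv, sub_zero, ENNReal.toReal_ofReal hs.le,
    ENNReal.toReal_ofReal', max_eq_right (Nat.cast_nonneg i), inv_mul_eq_div]
  congr 1
  push_cast
  rcases le_total s i with h | h
  · rw [min_eq_left h, min_eq_left (by linarith), max_eq_right (by linarith), sub_self]
  · rw [min_eq_right h, max_eq_left]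
    rw [sub_nonneg]
    exact le_min h (by linarith)

lemma antitone_ceilUniform_succ {s : ℝ} (hs : 0 < s) :
    Antitone fun i : ℕ => (ceilUniform s (i + 1)).toReal := by
  refine antitone_nat_of_succ_le fun i => ?_
  rw [ceilUniform_succ_toReal hs, ceilUniform_succ_toReal hs]
  refine div_le_div_of_nonneg_right ?_ hs.le
  push_cast
  rcases min_cases s ((i : ℝ) + 1 + 1) with h | h <;>
  rcases min_cases s ((i : ℝ) + 1) with h' | h' <;>
  rcases min_cases s (i : ℝ) with h'' | h'' <;> linarith

lemma sum_ceilUniform_succ {s : ℝ} (hs : 0 < s) (N : ℕ) :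
    ∑ i ∈ Finset.range N, (ceilUniform s (i + 1)).toReal = min s N / s := by
  simp only [ceilUniform_succ_toReal hs]
  rw [← Finset.sum_div, Finset.sum_range_sub fun i : ℕ => min s (i : ℝ)]
  simp [hs.le]

/-- Chebyshev's sum inequality for the random rank: the expected entry at a random rank of a
non-increasing sequence is at least `1 / max s N` times the sum of the first `N` entries. -/
lemma sum_div_max_le_sum_ceilUniform {s : ℝ} (hs : 0 < s) {v : ℕ → ℝ} (hv : Antitone v) (N : ℕ) :
    (∑ i ∈ Finset.range N, v i) / max s N ≤
      ∑ i ∈ Finset.range N, (ceilUniform s (i + 1)).toReal * v i := by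
  rcases N.eq_zero_or_pos with rfl | hN
  · simp
  have hN' : (0 : ℝ) < N := Nat.cast_pos.2 hN
  have hch := (((antitone_ceilUniform_succ hs).antitoneOn (Finset.range N : Set ℕ)).monovaryOn
    (hv.antitoneOn (Finset.range N : Set ℕ))).sum_mul_sum_le_card_mul_sum
  rw [sum_ceilUniform_succ hs, Finset.card_range] at hch
  have hmm : min s (N : ℝ) * max s N = s * N := min_mul_max s _
  have hmax : 0 < max s (N : ℝ) := hs.trans_le (le_max_left _ _)
  have e : min s (N : ℝ) / s = N / max s N := by
    rw [div_eq_div_iff hs.ne' hmax.ne', hmm, mul_comm]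
  rw [e, div_mul_eq_mul_div, mul_div_assoc] at hch
  exact le_of_mul_le_mul_left hch hN'

/-- The first entries of a list in non-increasing order have the largest sum. -/
lemma sum_le_sum_take {l t : List ℝ} (h : t.Sublist l) (hl : l.Pairwise fun a b => b ≤ a) :
    t.sum ≤ (l.take t.length).sum := by
  induction h with
  | slnil => simp
  | @cons t l a h ih =>
    rw [List.pairwise_cons] at hl
    rcases t with _ | ⟨b, t⟩
    · simp
    refine (ih hl.2).trans ?_
    have hlen : t.length < l.length := h.length_le
    rw [List.length_cons, List.take_succ_cons, List.sum_cons, List.sum_take_succ l _ hlen]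
    have := hl.1 _ (List.getElem_mem hlen)
    linarith
  | @cons_cons t l a h ih =>
    rw [List.pairwise_cons] at hl
    simpa using ih hl.2

end Rank

/-! ### One round of the linear-time policy -/

section Round

variable {E : Type u} {O : Type v}

lemma OracleComp.run_queryAll {α : Type u} (oracle : E → PartialRealization E O → ℝ)
    (ψ : PartialRealization E O) (l : List E) (next : List (E × ℝ) → OracleComp E O α) :
    (OracleComp.queryAll ψ l next).run oracle =
      ((next (l.map fun e => (e, oracle e ψ))).run oracle).map
        fun x => (x.1, x.2 + l.length) := by
  induction l generalizing next with
  | nil => exact (PMF.map_id _).symm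
  | cons e l ih =>
    simp only [OracleComp.queryAll, OracleComp.run, ih, PMF.map_comp, List.map_cons,
      List.length_cons, Function.comp_def, add_assoc]

lemma pick_elim_eq_getD {w : E → ℝ} (hw : ∀ e, 0 ≤ w e) {l : List (E × ℝ)}
    (hl : ∀ x ∈ l, x.2 = w x.1) (i : ℕ) :
    (pick l (i + 1)).elim 0 w = (l.map Prod.snd).getD i 0 := by
  rw [pick, Nat.add_sub_cancel, List.getD_eq_getElem?_getD, List.getElem?_map]
  rcases h : l[i]? with _ | ⟨e, x⟩
  · simp
  · have hx : x = w e := hl _ (List.mem_of_getElem? h)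
    simp [hx, hw e]

lemma antitone_getD {l : List ℝ} (h0 : ∀ x ∈ l, 0 ≤ x) (hl : l.Pairwise fun a b => b ≤ a) :
    Antitone fun i => l.getD i 0 := by
  intro i j hij
  rcases lt_or_ge j l.length with hj | hj
  · simp only [List.getD_eq_getElem _ _ hj, List.getD_eq_getElem _ _ (hij.trans_lt hj)]
    rcases hij.eq_or_lt with rfl | hlt
    · exact le_rfl
    · exact List.pairwise_iff_getElem.1 hl i j _ hj hlt
  · simp only [List.getD_eq_default _ _ hj]
    rcases lt_or_ge i l.length with hi | hi
    · simp only [List.getD_eq_getElem _ _ hi]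
      exact h0 _ (List.getElem_mem hi)
    · simp only [List.getD_eq_default _ _ hi, le_rfl]

lemma sum_take_eq_sum_getD (l : List ℝ) (N : ℕ) :
    (l.take N).sum = ∑ i ∈ Finset.range N, l.getD i 0 := by
  induction N with
  | zero => simp
  | succ N ih =>
    rw [Finset.sum_range_succ, ← ih]
    rcases lt_or_ge N l.length with h | h
    · rw [List.sum_take_succ l N h, List.getD_eq_getElem _ _ h]
    · rw [List.getD_eq_default _ _ h, add_zero, List.take_of_length_le h,
        List.take_of_length_le (by omega)]

variable [Fintype E] {sort : List (E × ℝ) → List (E × ℝ)} {k : ℕ} {q : ℝ}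

/-- The items of `S` with their values under `w`, in the order given by `sort`. -/
def ranking (sort : List (E × ℝ) → List (E × ℝ)) (w : E → ℝ) (S : Finset E) : List (E × ℝ) :=
  sort (S.toList.map fun e => (e, w e))

lemma run_step_linearTimePolicy (oracle : E → PartialRealization E O → ℝ) (r : ℕ)
    (ψ : PartialRealization E O) :
    ((linearTimePolicy E O sort k q).step r ψ).run oracle =
      (uniformSample E q).bind fun S =>
        (ceilUniform (k * sampleSize E q / Fintype.card E)).map fun j =>
          (pick (ranking sort (fun e => oracle e ψ) S) j, S.card) := by
  simp only [linearTimePolicy, OracleComp.run, OracleComp.run_queryAll, PMF.bind_bind,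
    PMF.bind_map, PMF.pure_map, Finset.length_toList, zero_add, ranking]
  rfl

variable [DecidableEq E]

/-- Given the sample `S`, the expected marginal utility of the item selected is at least the sum of
those of the `N` items of `S ∩ M`, divided by `max s N`. -/
lemma le_tsum_ceilUniform_pick (hsort : IsDescendingSort sort) {w : E → ℝ} (hw : ∀ e, 0 ≤ w e)
    {s : ℝ} (hs : 0 < s) (S M : Finset E) :
    (∑ e ∈ S ∩ M, w e) / max s (S ∩ M).card ≤
      ∑' j, (ceilUniform s j).toReal * (pick (ranking sort w S) j).elim 0 w := by
  obtain ⟨hperm, hdesc⟩ := hsort (S.toList.map fun e => (e, w e))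
  change (ranking sort w S).Perm _ at hperm
  change (ranking sort w S).Pairwise _ at hdesc
  set l := ranking sort w S
  have hl : ∀ x ∈ l, x.2 = w x.1 := fun x hx => by
    obtain ⟨e, -, rfl⟩ := List.mem_map.1 (hperm.mem_iff.1 hx)
    rfl
  set L := l.map Prod.snd with hL
  have hLdesc : L.Pairwise fun a b => b ≤ a := List.pairwise_map.2 hdesc
  have hL0 : ∀ x ∈ L, 0 ≤ x := fun x hx => by
    obtain ⟨y, hy, rfl⟩ := List.mem_map.1 hx
    rw [hl y hy]
    exact hw _
  have hLperm : L.Perm (S.toList.map w) := by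
    have := hperm.map Prod.snd
    rwa [List.map_map] at this
  set N := (S ∩ M).card with hN
  -- The first `N` entries of the sorted list dominate the items of `S ∩ M`.
  have hdom : ∑ e ∈ S ∩ M, w e ≤ ∑ i ∈ Finset.range N, L.getD i 0 := by
    have hsub : (((S ∩ M).toList.map w : List ℝ) : Multiset ℝ) ≤ (L : Multiset ℝ) := by
      rw [Multiset.coe_eq_coe.2 hLperm, ← Multiset.map_coe, ← Multiset.map_coe, Finset.coe_toList,
        Finset.coe_toList]
      exact Multiset.map_le_map (Finset.val_le_iff.2 Finset.inter_subset_left)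
    obtain ⟨t, ht, htL⟩ := Multiset.coe_le.1 hsub
    have hlen : t.length = N := by
      rw [ht.length_eq, List.length_map, Finset.length_toList]
    rw [← sum_take_eq_sum_getD, ← hlen, ← Finset.sum_map_toList, ← ht.sum_eq]
    exact sum_le_sum_take htL hLdesc
  have hbd : ∀ o : Option E, 0 ≤ o.elim 0 w ∧ o.elim 0 w ≤ ∑ e, w e := fun o => by
    cases o with
    | none => exact ⟨le_rfl, Finset.sum_nonneg fun e _ => hw e⟩
    | some e => exact ⟨hw e, Finset.single_le_sum (fun e _ => hw e) (Finset.mem_univ e)⟩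
  have hsum : Summable fun j => (ceilUniform s j).toReal * (pick l j).elim 0 w := by
    refine Summable.of_nonneg_of_le (fun j => mul_nonneg ENNReal.toReal_nonneg (hbd _).1)
      (fun j => mul_le_mul_of_nonneg_left (hbd _).2 ENNReal.toReal_nonneg)
      ((summable_toReal _).mul_right _)
  calc _ ≤ (∑ i ∈ Finset.range N, L.getD i 0) / max s N :=
        div_le_div_of_nonneg_right hdom (hs.le.trans (le_max_left _ _))
    _ ≤ ∑ i ∈ Finset.range N, (ceilUniform s (i + 1)).toReal * L.getD i 0 :=
        sum_div_max_le_sum_ceilUniform hs (antitone_getD hL0 hLdesc) N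
    _ = ∑ j ∈ (Finset.range N).map ⟨Nat.succ, Nat.succ_injective⟩,
          (ceilUniform s j).toReal * (pick l j).elim 0 w := by
        rw [Finset.sum_map]
        exact Finset.sum_congr rfl fun i _ => by
          rw [hL, ← pick_elim_eq_getD hw hl]
          rfl
    _ ≤ _ := hsum.sum_le_tsum _ fun j _ => mul_nonneg ENNReal.toReal_nonneg (hbd _).1

/-- A round of the linear-time policy gains in expectation at least a `(1 - ε) / k` fraction of the
total marginal utility of any `k` items, if the samples are large enough. -/
lemma le_gain_linearTimePolicy (hsort : IsDescendingSort sort) (hk : 1 ≤ k)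
    (hkn : k ≤ Fintype.card E) {ε : ℝ} (hε : 0 < ε) (hε1 : ε ≤ 1) (hq : 0 < q)
    (hqk : 1 ≤ 4 * ε ^ 2 * (k * q)) {oracle : E → PartialRealization E O → ℝ}
    (horacle : ∀ e ψ, 0 ≤ oracle e ψ) (r : ℕ) (ψ : PartialRealization E O) (M : Finset E)
    (hM : M.card ≤ k) :
    (1 - ε) / k * ∑ e ∈ M, oracle e ψ ≤ (linearTimePolicy E O sort k q).gain oracle r ψ := by
  have hn : 0 < Fintype.card E := by omega
  have hn' : (0 : ℝ) < Fintype.card E := Nat.cast_pos.2 hn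
  have hk' : (0 : ℝ) < k := Nat.cast_pos.2 hk
  have hm : sampleSize E q ≤ Fintype.card E := min_le_right _ _
  have hm0 : (0 : ℝ) < sampleSize E q :=
    Nat.cast_pos.2 (lt_min (Nat.ceil_pos.2 (mul_pos hq hn')) hn)
  set s : ℝ := k * sampleSize E q / Fintype.card E with hs
  have hs0 : 0 < s := by positivity
  have hcases : sampleSize E q = Fintype.card E ∨ 1 ≤ 4 * ε ^ 2 * s := by
    rcases le_total ⌈q * Fintype.card E⌉₊ (Fintype.card E) with h | h
    · right
      have : k * q ≤ s := by
        rw [hs, mul_div_assoc]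
        refine mul_le_mul_of_nonneg_left ?_ hk'.le
        rw [le_div_iff₀ hn', sampleSize, min_eq_left h]
        exact Nat.le_ceil _
      exact hqk.trans (mul_le_mul_of_nonneg_left this (by positivity))
    · exact .inl (min_eq_right h)
  obtain ⟨M', hMM', -, hM'⟩ := Finset.exists_subsuperset_card_eq (Finset.subset_univ M) hM
    (by rwa [Finset.card_univ])
  have hgain : (linearTimePolicy E O sort k q).gain oracle r ψ =
      ∑ S, (uniformSample E q S).toReal * ∑' j, (ceilUniform s j).toReal *
        (pick (ranking sort (fun e => oracle e ψ) S) j).elim 0 fun e => oracle e ψ := by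
    simp only [Policy.gain, Policy.decision, run_step_linearTimePolicy, PMF.map_bind, PMF.map_comp,
      Function.comp_def]
    rw [sum_toReal_bind, tsum_fintype]
    simp only [sum_toReal_map, hs]
  set P := Finset.powersetCard (sampleSize E q) (Finset.univ : Finset E) with hP
  have hP0 : (0 : ℝ) < P.card := by
    refine Nat.cast_pos.2 (Finset.card_pos.2 (Finset.powersetCard_nonempty.2 ?_))
    rwa [Finset.card_univ]
  have hunif : ∀ S ∈ P, (uniformSample E q S).toReal = (P.card : ℝ)⁻¹ := fun S hS => by
    rw [uniformSample, PMF.uniformOfFinset_apply_of_mem _ hS, ENNReal.toReal_inv,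
      ENNReal.toReal_natCast]
  have hlow := le_sum_sample hn hM' hs hs0 hε hcases (w := fun e => oracle e ψ)
    fun e => horacle e ψ
  rw [← hP] at hlow
  have hinner : ∀ S : Finset E, 0 ≤ (∑ e ∈ S ∩ M', oracle e ψ) / max s (S ∩ M').card := fun S =>
    div_nonneg (Finset.sum_nonneg fun e _ => horacle e ψ) (hs0.le.trans (le_max_left _ _))
  have hpick := fun S => le_tsum_ceilUniform_pick hsort (w := fun e => oracle e ψ)
    (fun e => horacle e ψ) hs0 S M'
  calc (1 - ε) / k * ∑ e ∈ M, oracle e ψ ≤ (1 - ε) / k * ∑ e ∈ M', oracle e ψ :=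
        mul_le_mul_of_nonneg_left
          (Finset.sum_le_sum_of_subset_of_nonneg hMM' fun e _ _ => horacle e ψ)
          (div_nonneg (by linarith) hk'.le)
    _ ≤ ∑ S ∈ P, (P.card : ℝ)⁻¹ * ((∑ e ∈ S ∩ M', oracle e ψ) / max s (S ∩ M').card) := by
        rw [← Finset.mul_sum, inv_mul_eq_div, le_div_iff₀ hP0]
        exact hlow
    _ ≤ ∑ S ∈ P, (uniformSample E q S).toReal * ∑' j, (ceilUniform s j).toReal *
        (pick (ranking sort (fun e => oracle e ψ) S) j).elim 0 fun e => oracle e ψ :=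
        Finset.sum_le_sum fun S hS => by
          rw [hunif S hS]
          exact mul_le_mul_of_nonneg_left (hpick S) (inv_nonneg.2 hP0.le)
    _ ≤ _ := by
        rw [hgain]
        exact Finset.sum_le_sum_of_subset_of_nonneg (Finset.subset_univ _) fun S _ _ =>
          mul_nonneg ENNReal.toReal_nonneg ((hinner S).trans (hpick S))

/-- In `r` rounds the linear-time policy selects at most `r` items, and it makes as many queries per
round as there are items in a sample. -/
lemma card_le_and_queries_eq_of_mem_support (oracle : E → PartialRealization E O → ℝ)
    (φ : E → O) (r : ℕ) (x : Finset E × ℕ)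
    (hx : x ∈ ((linearTimePolicy E O sort k q).runRounds oracle φ r).support) :
    x.1.card ≤ r ∧ x.2 = r * sampleSize E q := by
  induction r generalizing x with
  | zero =>
    rw [Policy.runRounds, PMF.support_pure, Set.mem_singleton_iff] at hx
    simp [hx]
  | succ r ih =>
    simp only [Policy.runRounds, run_step_linearTimePolicy, PMF.mem_support_bind_iff,
      PMF.mem_support_map_iff] at hx
    obtain ⟨y, hy, z, ⟨S, hS, j, -, rfl⟩, rfl⟩ := hx
    obtain ⟨h1, h2⟩ := ih y hy
    have hcard : S.card = sampleSize E q := by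
      rw [uniformSample, PMF.mem_support_uniformOfFinset_iff, Finset.mem_powersetCard] at hS
      exact hS.2
    refine ⟨(Finset.card_union_le _ _).trans (add_le_add h1 ?_), ?_⟩
    · generalize pick _ j = o
      cases o <;> simp
    · change y.2 + S.card = _
      rw [h2, hcard, Nat.succ_mul]

end Round

/-! ### Estimates for the parameters -/

section Numerics

lemma exp_sub_one_le {ε : ℝ} (h0 : 0 ≤ ε) (h1 : ε ≤ 1) :
    Real.exp (ε - 1) ≤ 1 / Real.exp 1 + ε := by
  have h := convexOn_exp.2 (Set.mem_univ (-1)) (Set.mem_univ 0) (sub_nonneg.2 h1) h0 (by ring)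
  simp only [smul_eq_mul, mul_zero, add_zero, Real.exp_zero, mul_one] at h
  rw [show (1 - ε) * -1 = ε - 1 by ring, Real.exp_neg] at h
  rw [one_div]
  have : 0 ≤ ε * (Real.exp 1)⁻¹ := by positivity
  linarith

lemma one_sub_one_sub_div_pow_ge {ε : ℝ} {k : ℕ} (hk : 1 ≤ k) (h0 : 0 ≤ ε) (h1 : ε ≤ 1) :
    1 - 1 / Real.exp 1 - ε ≤ 1 - (1 - (1 - ε) / k) ^ k := by
  have hk' : (1 : ℝ) ≤ k := by exact_mod_cast hk
  have hle : (1 - ε) / k ≤ 1 := (div_le_one (by linarith)).2 (by linarith)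
  have h : (1 - (1 - ε) / k) ^ k ≤ Real.exp (ε - 1) := by
    calc _ ≤ Real.exp (-((1 - ε) / k)) ^ k :=
          pow_le_pow_left₀ (by linarith) (Real.one_sub_le_exp_neg _) k
      _ = _ := by
          rw [← Real.exp_nat_mul]
          congr 1
          field_simp
          ring
  linarith [exp_sub_one_le h0 h1]

/-- What the two choices of the parameter `q` have in common. -/
lemma parameter_bounds {ε q : ℝ} {k : ℕ} (hk : 1 ≤ k) (hε : 0 < ε)
    (h : (ε ≤ 12 / 25 ∧ q = 8 * (k : ℝ)⁻¹ * (ε ^ 2)⁻¹ * Real.log ((2 * ε)⁻¹)) ∨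
      (ε < 1 - 1 / Real.exp 1 ∧ q = 8 * (k : ℝ)⁻¹ * (ε ^ 2)⁻¹ * Real.log (2 * ε⁻¹))) :
    ε ≤ 1 ∧ 0 < q ∧ 1 ≤ 4 * ε ^ 2 * (k * q) ∧ 1 ≤ 3 * Real.log ε⁻¹ ∧
      k * q ≤ 32 * (ε ^ 2)⁻¹ * Real.log ε⁻¹ := by
  have hk' : (0 : ℝ) < k := Nat.cast_pos.2 hk
  have hlog : 1 - ε ≤ Real.log ε⁻¹ := by
    have := Real.log_le_sub_one_of_pos hε
    rw [Real.log_inv]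
    linarith
  have hlog2 : Real.log 2 ≤ 1 := by
    have := Real.log_le_sub_one_of_pos (show (0 : ℝ) < 2 by norm_num)
    linarith
  suffices H : ∀ L : ℝ, q = 8 * (k : ℝ)⁻¹ * (ε ^ 2)⁻¹ * L → ε ≤ 1 → 1 / 32 ≤ L →
      1 ≤ 3 * Real.log ε⁻¹ → L ≤ 4 * Real.log ε⁻¹ → _ by
    rcases h with ⟨hε', hq⟩ | ⟨hε', hq⟩
    · have h2 : Real.log (2 * ε)⁻¹ = Real.log ε⁻¹ - Real.log 2 := by
        rw [mul_inv, Real.log_mul (by norm_num) (by positivity), Real.log_inv 2]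
        ring
      have h3 : 0 ≤ Real.log 2 := Real.log_nonneg (by norm_num)
      refine H _ hq (by linarith) ?_ (by linarith) (by linarith)
      have := Real.log_le_sub_one_of_pos (show 0 < 2 * ε by positivity)
      rw [Real.log_inv]
      linarith
    · have h2 : Real.log (2 * ε⁻¹) = Real.log 2 + Real.log ε⁻¹ :=
        Real.log_mul (by norm_num) (by positivity)
      have h3 : 0 ≤ Real.log 2 := Real.log_nonneg (by norm_num)
      have he : 1 / 3 < 1 / Real.exp 1 :=
        one_div_lt_one_div_of_lt (Real.exp_pos 1) Real.exp_one_lt_three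
      refine H _ hq (by linarith) (by linarith) (by linarith) (by linarith)
  intro L hq hε1 hL hl hL4
  have hkq : k * q = 8 * (ε ^ 2)⁻¹ * L := by
    rw [hq]
    field_simp
  have hinv : 0 < (ε ^ 2)⁻¹ := by positivity
  refine ⟨hε1, ?_, ?_, hl, ?_⟩
  · rw [hq]
    have : 0 < L := by linarith
    positivity
  · rw [hkq]
    have : 4 * ε ^ 2 * (8 * (ε ^ 2)⁻¹ * L) = 32 * L := by
      field_simp
      norm_num
    linarith
  · rw [hkq]
    have := mul_le_mul_of_nonneg_left hL4 hinv.le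
    linarith

/-- The query count: rounding up `q n` costs at most `k ≤ n` queries in total, which
`1 ≤ 3 ε⁻² log ε⁻¹` absorbs. -/
lemma mul_sampleSize_le {E : Type u} [Fintype E] {k : ℕ} {ε q : ℝ} (hkn : k ≤ Fintype.card E)
    (hε : 0 < ε) (hε1 : ε ≤ 1) (hq : 0 < q) (hl : 1 ≤ 3 * Real.log ε⁻¹)
    (hkq : k * q ≤ 32 * (ε ^ 2)⁻¹ * Real.log ε⁻¹) :
    (k : ℝ) * sampleSize E q ≤ 35 * (Fintype.card E * (ε ^ 2)⁻¹ * Real.log ε⁻¹) := by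
  set n : ℝ := (Fintype.card E : ℝ)
  have hn : 0 ≤ n := Nat.cast_nonneg _
  have hkn' : (k : ℝ) ≤ n := Nat.cast_le.2 hkn
  have hm : (sampleSize E q : ℝ) ≤ q * n + 1 :=
    (Nat.cast_le.2 (min_le_left _ _)).trans (Nat.ceil_lt_add_one (by positivity)).le
  have hinv : 1 ≤ (ε ^ 2)⁻¹ := one_le_inv₀ (by positivity) |>.2 (pow_le_one₀ hε.le hε1)
  have h1 : 1 ≤ (ε ^ 2)⁻¹ * (3 * Real.log ε⁻¹) := one_le_mul_of_one_le_of_one_le hinv hl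
  have h2 := mul_le_mul_of_nonneg_left hm (Nat.cast_nonneg (α := ℝ) k)
  have h3 := mul_le_mul_of_nonneg_left hkq hn
  have h4 := mul_le_mul_of_nonneg_left h1 hn
  linarith

end Numerics

end AdaptiveMax

end

theorem mainTheorem3 :
    ∃ C : ℝ, 0 < C ∧
      ∀ (E : Type u) (O : Type v) [Fintype E] [DecidableEq E]
        (p : PMF (E → O)) (f : Finset E → (E → O) → ℝ)
        (sort : List (E × ℝ) → List (E × ℝ)) (k : ℕ) (ε q : ℝ),
        (∀ S φ, 0 ≤ f S φ) →
        (∀ S, Summable fun φ => (p φ).toReal * f S φ) →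
        AdaptiveSubmodular p f →
        AdaptiveMonotone p f →
        IsDescendingSort sort →
        1 ≤ k → k ≤ Fintype.card E →
        0 < ε →
        ((ε ≤ 12 / 25 ∧ q = 8 * (k : ℝ)⁻¹ * (ε ^ 2)⁻¹ * Real.log ((2 * ε)⁻¹)) ∨
          (ε < 1 - 1 / Real.exp 1 ∧ q = 8 * (k : ℝ)⁻¹ * (ε ^ 2)⁻¹ * Real.log (2 * ε⁻¹))) →
        -- the policy is feasible
        (linearTimePolicy E O sort k q).Feasible p f k ∧
        -- it has the approximation ratio `1 - 1 / e - ε` against every feasible policy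
        (∀ π : Policy E O, π.Feasible p f k →
          (1 - 1 / Real.exp 1 - ε) * π.favg p f ≤ (linearTimePolicy E O sort k q).favg p f) ∧
        -- every execution makes `O(n ε⁻² log ε⁻¹)` value oracle queries
        (∀ φ : E → O, ∀ x ∈ ((linearTimePolicy E O sort k q).run p f φ).support,
          (x.2 : ℝ) ≤ C * (Fintype.card E * (ε ^ 2)⁻¹ * Real.log (ε⁻¹))) := by
  refine ⟨35, by norm_num, ?_⟩
  intro E O _ _ p f sort k ε q hf0 hf hs hm hsort hk hkn hε hq
  obtain ⟨hε1, hq0, hqk, hl, hkq⟩ := parameter_bounds hk hε hq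
  refine ⟨fun φ A hA => ?_, fun π hπ => ?_, fun φ x hx => ?_⟩
  · obtain ⟨x, hx, rfl⟩ := (PMF.mem_support_map_iff _ _ _).1 hA
    exact (card_le_and_queries_eq_of_mem_support _ φ k x hx).1
  · have hk' : (1 : ℝ) ≤ k := by exact_mod_cast hk
    have hfav : 0 ≤ π.favg p f := tsum_nonneg fun φ => mul_nonneg ENNReal.toReal_nonneg
      (Finset.sum_nonneg fun A _ => mul_nonneg ENNReal.toReal_nonneg (hf0 A φ))
    refine (mul_le_mul_of_nonneg_right (one_sub_one_sub_div_pow_ge hk hε.le hε1) hfav).trans ?_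
    exact Policy.value_ge hf0 hf hs hm (div_nonneg (sub_nonneg.2 hε1) (by linarith))
      ((div_le_one (by linarith)).2 (by linarith))
      (fun r ψ M hM => le_gain_linearTimePolicy hsort hk hkn hε hε1 hq0 hqk
        (fun e ψ => hm.marginal_nonneg e ψ) r ψ M hM) hπ k
  · rw [(card_le_and_queries_eq_of_mem_support _ φ k x hx).2, Nat.cast_mul]
    exact mul_sampleSize_le hkn hε hε1 hq0 hl hkq
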